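/- Consider $N\ge 1$ flows of update packets sent through a queue with an infinite buffer and $M\ge 1$ servers. The $i$-th packet of flow $n$ is generated at time $S_{n,i}$ and arrives at the queue at time $A_{n,i}$, where $0\le S_{n,1}\le S_{n,2}\le\cdots$ and $S_{n,i}\le A_{n,i}$; arrivals may be out of order, and only finitely many packets arrive in any bounded time interval. Generations and arrivals are synchronized across the flows: $S_{n,i}=S_i$ and $A_{n,i}=A_i$ for all $n$ and $i$. Let $\mathcal I=\{S_i,A_i : i\ge 1\}$. The packet service times are i.i.d. across servers and time, independent of $\mathcal I$, and distributed as a non-negative random variable $X$ that is New-Better-than-Used: $\Pr[X>\tau+t]\le \Pr[X>\tau]\,\Pr[X>t]$ for all $\tau,t\ge 0$. Let $\Pi_{np}$ be the set of non-preemptive causal policies: a server completes the packet it is serving before it starts another one, and each decision is based only on the history and the current state of the system. For $\pi\in\Pi_{np}$ let $V_{n,i}$ and $D_{n,i}$ be the times at which service of the $i$-th packet of flow $n$ starts and ends. The age of flow $n$ at time $t$ is $\Delta_n(t)=t-\max\{S_{n,i}: D_{n,i}\le t\}$, and its age of served information is $\Xi_n(t)=t-\max\{S_{n,i}: V_{n,i}\le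 t\}$, where in both maxima the initial time stamp $-\delta_n$ is included; here $\delta_n\ge 0$ is a given initial age of flow $n$ at time $0^-$, the same for all policies. Let $$[\bar\Delta_\pi\mid\mathcal I]=\limsup_{T\to\infty}\frac1T\,\mathbb E\Big[\int_0^T \frac1N\sum_{n=1}^N\Delta_n(t)\,dt\;\Big|\;\mathcal I\Big]\in[0,\infty].$$ The non-preemptive MASIF-LGFS policy is the work-conserving policy in $\Pi_{np}$ (all servers are busy whenever the queue is non-empty) in which each service goes to a last generated queued packet of a flow that has the maximum age of served information, at that moment, among the flows with a packet in the queue; ties are broken arbitrarily. Then for all $\mathcal I$ and all $\delta_1,\dots,\delta_N\ge 0$, $$\inf_{\pi\in\Pi_{np}}[\bar\Delta_\pi\mid\mathcal I]\;\le\;[\bar\Delta_{\text{non-prmp, MASIF-LGFS}}\mid\mathcal I]\;\le\;\inf_{\pi\in\Pi_{np}}[\bar\Delta_\pi\mid\mathcal I]+\mathbb E[X].$$ -/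

import Mathlib

open MeasureTheory ProbabilityTheory Filter Set
open scoped NNReal ENNReal

namespace StatusUpdate

/-- Generation and arrival times of the packets of `N` flows: the `i`-th packet of flow `n`
is generated at time `gen n i` and arrives at the queue at time `arr n i`. Arrivals may be out
of order. Only finitely many packets arrive in any bounded time interval. -/
structure Traffic (N : ℕ) where
  gen : Fin N → ℕ → ℝ≥0
  arr : Fin N → ℕ → ℝ≥0
  gen_mono : ∀ n, Monotone (gen n)
  gen_le_arr : ∀ n i, gen n i ≤ arr n i
  finite_arr : ∀ (n : Fin N) (t : ℝ≥0), {i : ℕ | arr n i ≤ t}.Finite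

/-- Synchronized sampling and arrivals: all flows have the same generation and arrival times. -/
def Traffic.Synchronized {N : ℕ} (I : Traffic N) : Prop :=
  ∃ s a : ℕ → ℝ≥0, ∀ n i, I.gen n i = s i ∧ I.arr n i = a i

/-- A packet is named by its flow and its number within the flow. -/
abbrev Packet (N : ℕ) := Fin N × ℕ

/-- A non-preemptive causal scheduling policy for `M` servers and the traffic `I`. The services
are numbered `0, 1, 2, …` in the order in which they start, and `x k` is the service time of the
`k`-th of them. On the service times `x`, and with the random seed `u` (for policies that
randomize), the `k`-th service starts at time `start u x k` (`⊤`: there is no `k`-th service),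
serves `packet u x k` on `server u x k`, and ends at time `start u x k + x k`; it is never
interrupted. -/
structure Policy {N : ℕ} (M : ℕ) (I : Traffic N) (𝒰 : Type*) [MeasurableSpace 𝒰] where
  start : 𝒰 → (ℕ → ℝ≥0) → ℕ → ℝ≥0∞
  packet : 𝒰 → (ℕ → ℝ≥0) → ℕ → Packet N
  server : 𝒰 → (ℕ → ℝ≥0) → ℕ → Fin M
  measurable_start : ∀ k, Measurable fun z : 𝒰 × (ℕ → ℝ≥0) => start z.1 z.2 k
  measurable_packet : ∀ k, Measurable fun z : 𝒰 × (ℕ → ℝ≥0) => packet z.1 z.2 k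
  measurable_server : ∀ k, Measurable fun z : 𝒰 × (ℕ → ℝ≥0) => server z.1 z.2 k
  start_mono : ∀ u x, Monotone (start u x)
  /-- A packet is not served before it has arrived. -/
  arrived : ∀ u x k, start u x k ≠ ⊤ →
    (I.arr (packet u x k).1 (packet u x k).2 : ℝ≥0∞) ≤ start u x k
  /-- No packet is served twice. -/
  served_once : ∀ u x j k, j < k → start u x k ≠ ⊤ → packet u x j ≠ packet u x k
  /-- A server completes its current service before it starts another one. -/
  server_free : ∀ u x j k, j < k → start u x k ≠ ⊤ → server u x j = server u x k →
    start u x j + x j ≤ start u x k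
  /-- Causality: the `k`-th decision depends only on what has been observed when it is made.
  If on `x` and on `x'` every earlier service either has the same service time or is still
  unfinished at the time of the `k`-th start, then the `k`-th decision is the same. -/
  causal : ∀ u x x' k,
    (∀ j < k, x j = x' j ∨
      (start u x k < start u x j + x j ∧ start u x k < start u x j + x' j)) →
    start u x' k = start u x k ∧
      (start u x k ≠ ⊤ → packet u x' k = packet u x k ∧ server u x' k = server u x k)

namespace Policy

variable {N M : ℕ} {I : Traffic N} {𝒰 : Type*} [MeasurableSpace 𝒰]

/-- The generation time of the freshest packet of flow `n` among those of the services in `K`;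
`δ n` is the age of flow `n` at time `0⁻`, so `-δ n` is the initial time stamp. -/
noncomputable def freshest (π : Policy M I 𝒰) (δ : Fin N → ℝ≥0) (u : 𝒰) (x : ℕ → ℝ≥0)
    (n : Fin N) (K : Set ℕ) : ℝ :=
  sSup (insert (-(δ n : ℝ))
    {s : ℝ | ∃ k ∈ K, (π.packet u x k).1 = n ∧ s = I.gen n (π.packet u x k).2})

/-- The age of flow `n` at time `t`, determined by the packets delivered by time `t`. -/
noncomputable def age (π : Policy M I 𝒰) (δ : Fin N → ℝ≥0) (u : 𝒰) (x : ℕ → ℝ≥0)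
    (n : Fin N) (t : ℝ) : ℝ :=
  t - π.freshest δ u x n {k | π.start u x k + x k ≤ ENNReal.ofReal t}

/-- The average age of the `N` flows at time `t`. -/
noncomputable def avgAge (π : Policy M I 𝒰) (δ : Fin N → ℝ≥0) (u : 𝒰) (x : ℕ → ℝ≥0)
    (t : ℝ) : ℝ :=
  (1 / (N : ℝ)) * ∑ n, π.age δ u x n t

/-- The age of served information of flow `n` at the time of the `k`-th service start, just
before that start is taken into account: it is determined by the services `j < k`, which are
those that have started already. -/
noncomputable def servedAge (π : Policy M I 𝒰) (δ : Fin N → ℝ≥0) (u : 𝒰) (x : ℕ → ℝ≥0)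
    (n : Fin N) (k : ℕ) : ℝ :=
  (π.start u x k).toReal - π.freshest δ u x n {j | j < k}

/-- Packet `p` is in the queue when the `k`-th service is about to start. -/
def Waiting (π : Policy M I 𝒰) (u : 𝒰) (x : ℕ → ℝ≥0) (k : ℕ) (p : Packet N) : Prop :=
  (I.arr p.1 p.2 : ℝ≥0∞) ≤ π.start u x k ∧ ∀ j < k, π.packet u x j ≠ p

/-- All servers are busy at every time at which the queue is non-empty. -/
def WorkConserving (π : Policy M I 𝒰) : Prop :=
  ∀ (u : 𝒰) (x : ℕ → ℝ≥0) (t : ℝ≥0) (p : Packet N), I.arr p.1 p.2 ≤ t →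
    (∀ k, π.start u x k ≤ t → π.packet u x k ≠ p) →
    ∀ m : Fin M, ∃ k, π.server u x k = m ∧ π.start u x k ≤ t ∧ t < π.start u x k + x k

/-- Maximum Age of Served Information First, Last Generated First Served: the policy is
work-conserving, and each service goes to a flow with the maximum age of served information
among the flows that have a packet in the queue, and to a last generated packet of that flow
in the queue. Ties are broken arbitrarily. -/
structure IsMASIFLGFS (π : Policy M I 𝒰) (δ : Fin N → ℝ≥0) : Prop where
  workConserving : π.WorkConserving
  masif : ∀ u x k, π.start u x k ≠ ⊤ → ∀ p, π.Waiting u x k p →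
    π.servedAge δ u x p.1 k ≤ π.servedAge δ u x (π.packet u x k).1 k
  lgfs : ∀ u x k, π.start u x k ≠ ⊤ → ∀ p, π.Waiting u x k p → p.1 = (π.packet u x k).1 →
    I.gen p.1 p.2 ≤ I.gen (π.packet u x k).1 (π.packet u x k).2

/-- The expected long-run time-average of the average age of the flows,
`limsup_{T → ∞} (1/T) E[∫₀ᵀ avgAge(t) dt]`, when the service times are `X` and the seed is `U`.
The average age is non-negative at all times `t ≥ 0`. -/
noncomputable def longRunAge (π : Policy M I 𝒰) (δ : Fin N → ℝ≥0)
    {Ω : Type*} [MeasurableSpace Ω] (P : Measure Ω) (X : ℕ → Ω → ℝ≥0) (U : Ω → 𝒰) : ℝ≥0∞ :=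
  limsup (fun T : ℝ =>
    (∫⁻ ω, (∫⁻ t in Ioc 0 T, ENNReal.ofReal (π.avgAge δ (U ω) (fun k => X k ω) t)) ∂P)
      / ENNReal.ofReal T) atTop

end Policy

/-- New-Better-than-Used: `F̄(τ + t) ≤ F̄(τ) F̄(t)` for the complementary cumulative distribution
function `F̄(y) = Pr[X > y]` of the non-negative random variable `X`. -/
def IsNBU {Ω : Type*} [MeasurableSpace Ω] (P : Measure Ω) (X : Ω → ℝ≥0) : Prop :=
  ∀ τ t : ℝ≥0, P {ω | τ + t < X ω} ≤ P {ω | τ < X ω} * P {ω | t < X ω}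

end StatusUpdate

/-!
The lower bound holds because the MASIF-LGFS policy is itself one of the competing policies. The
upper bound combines two facts about the *served* information, that is, the packets whose service
has started.

*Served information under MASIF-LGFS beats delivered information under any policy, in expectation at
every time `t`.* It suffices to compare, for each level `v`, the laws of the number of flows that
have a packet generated at time `v` or later (`lintegral_sum_ofReal_sub_le`). By synchronization
there is a single time `a` at which such packets first arrive. Under any policy, this number grows
by at most one with each service that both starts and ends in `[a, t]`; under MASIF-LGFS it grows by
one with each service that starts in `[a, t]`, until it reaches `N`, and it is `N` as soon as a
server has been idle. So only two counts of services have to be compared. Both are compared with a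
third one: the number of completions of `M` servers that start afresh at time `a` and stay busy.
The probability `reach` that this third count attains a given value, as a function of the current
server state, is a martingale along the services of any policy, taken in the order of their starts,
if every service is moved forward to the time at which its server becomes free. Moving services
forward can only increase the count of completions (`Policy.measure_completions_le`). In a busy
system nothing is moved, and the only difference to the third count is that a server may be in the
middle of a service at time `a`. The residual service time is stochastically smaller than a fresh
one, by the New-Better-than-Used property, so `reach` becomes a submartingale
(`Policy.le_measure_starts`). The martingale properties rest on causality, in the form that the
`k`-th decision does not depend on the `k`-th and later service times.

*Served and delivered information differ little.* A level `v` of flow `n` lies between the two only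
while the service that first reaches this level is in progress. This service is chosen before its
duration is known, so the expected time is at most the mean service time. Integrating over the
levels between `-δ n` and the horizon `T` bounds the integrated gap by `(T + δ n)` times the mean
service time (`Policy.lintegral_age_le_servedAge_add`), and dividing by `T` gives the theorem.
-/

namespace StatusUpdate

/-! ### Resampling coordinates of a product measure -/

section Resampling

variable {ι κ : Type*} {S : Type*} [MeasurableSpace S] (μ : Measure S) [IsProbabilityMeasure μ]

/-- Adjoining one independent sample to an i.i.d. family gives an i.i.d. family indexed by
`Option ι`. -/
lemma map_optionElim_infinitePi :
    (μ.prod (Measure.infinitePi fun _ : ι => μ)).map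
        (fun z (o : Option ι) => o.elim z.1 z.2) =
      Measure.infinitePi fun _ : Option ι => μ := by
  classical
  have hm : Measurable fun (z : S × (ι → S)) (o : Option ι) => o.elim z.1 z.2 := by
    refine measurable_pi_lambda _ fun o => ?_
    cases o with
    | none => exact measurable_fst
    | some i => exact (measurable_pi_apply i).comp measurable_snd
  refine Measure.eq_infinitePi _ fun s t ht => ?_
  rw [Measure.map_apply hm (.pi s.countable_toSet fun i _ => ht i)]
  have hpre : (fun (z : S × (ι → S)) (o : Option ι) => o.elim z.1 z.2) ⁻¹' (Set.pi s t) =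
      (if none ∈ s then t none else univ) ×ˢ (Set.pi (s.eraseNone : Set ι) fun i => t (some i)) := by
    ext ⟨y, x⟩
    simp only [Set.mem_preimage, Set.mem_pi, Finset.mem_coe, Set.mem_prod, Finset.mem_eraseNone]
    constructor
    · intro h
      refine ⟨?_, fun i hi => h _ hi⟩
      split_ifs with hn
      · exact h _ hn
      · trivial
    · rintro ⟨h1, h2⟩ (_ | i) ho
      · simpa [ho] using h1
      · exact h2 i ho
  rw [hpre, Measure.prod_prod, Measure.infinitePi_pi _ (fun i _ => ht _)]
  have hprod : ∏ i ∈ s.eraseNone, μ (t (some i)) = ∏ o ∈ s.erase none, μ (t o) := by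
    rw [← Finset.map_some_eraseNone, Finset.prod_map]
    rfl
  rw [hprod]
  by_cases hn : none ∈ s
  · rw [if_pos hn, Finset.mul_prod_erase s (fun o => μ (t o)) hn]
  · rw [if_neg hn, measure_univ, one_mul, Finset.erase_eq_of_notMem hn]

/-- Filling the coordinates of an i.i.d. family from an independent fresh sample (at most one
coordinate, where `f` is `none`) and from distinct coordinates of another such family does not
change its law. -/
lemma map_optionElim_comp_infinitePi {f : κ → Option ι} (hf : Function.Injective f) :
    (μ.prod (Measure.infinitePi fun _ : ι => μ)).map (fun z k => (f k).elim z.1 z.2) =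
      Measure.infinitePi fun _ : κ => μ := by
  have hm : Measurable fun (z : S × (ι → S)) (o : Option ι) => o.elim z.1 z.2 := by
    refine measurable_pi_lambda _ fun o => ?_
    cases o with
    | none => exact measurable_fst
    | some i => exact (measurable_pi_apply i).comp measurable_snd
  have h := Measure.map_infinitePi_infinitePi_of_inj (P := fun _ : Option ι => μ) hf
  rw [← map_optionElim_infinitePi, Measure.map_map (by fun_prop) hm] at h
  exact h

/-- Redrawing one coordinate of an i.i.d. family does not change its law. -/
lemma lintegral_update_infinitePi [DecidableEq ι] (i : ι) {g : (ι → S) → ℝ≥0∞} (hg : Measurable g) :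
    ∫⁻ x, g x ∂(Measure.infinitePi fun _ : ι => μ) =
      ∫⁻ x, ∫⁻ y, g (Function.update x i y) ∂μ ∂(Measure.infinitePi fun _ : ι => μ) := by
  have hf : Function.Injective fun j : ι => if j = i then none else some j := by
    intro j k h
    by_cases hj : j = i <;> by_cases hk : k = i <;> simp_all
  have hupd : (fun (z : S × (ι → S)) k => ((fun j : ι => if j = i then none else some j) k).elim
      z.1 z.2) = fun z => Function.update z.2 i z.1 := by
    ext z k
    by_cases hk : k = i
    · subst hk; simp
    · simp [hk]
  have hm : Measurable fun z : S × (ι → S) => Function.update z.2 i z.1 := by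
    rw [← hupd]
    refine measurable_pi_lambda _ fun k => ?_
    by_cases hk : k = i
    · simpa [hk] using measurable_fst
    · simp only [hk, if_false, Option.elim]
      exact (measurable_pi_apply k).comp measurable_snd
  conv_lhs => rw [← map_optionElim_comp_infinitePi μ hf, hupd]
  exact (lintegral_map hg hm).trans (lintegral_prod_symm' _ (hg.comp hm))

end Resampling

/-! ### New-Better-than-Used laws -/

lemma measure_Ici_le_of_Ioi {κ₁ κ₂ : Measure ℝ≥0} [IsFiniteMeasure κ₂]
    (h : ∀ q, κ₁ (Ioi q) ≤ κ₂ (Ioi q)) {q : ℝ≥0} (hq : 0 < q) : κ₁ (Ici q) ≤ κ₂ (Ici q) := by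
  obtain ⟨r, hr, hrq, hlim⟩ := exists_seq_strictMono_tendsto' hq
  have hI : Ici q = ⋂ n, Ioi (r n) := by
    ext y
    simp only [mem_Ici, mem_iInter, mem_Ioi]
    exact ⟨fun hy n => (hrq n).2.trans_le hy, fun hy => le_of_tendsto' hlim fun n => (hy n).le⟩
  have ht : Tendsto (fun n => κ₂ (Ioi (r n))) atTop (nhds (κ₂ (Ici q))) := by
    rw [hI]
    exact tendsto_measure_iInter_atTop (fun n => measurableSet_Ioi.nullMeasurableSet)
      (fun m n hmn => Ioi_subset_Ioi (hr.monotone hmn)) ⟨0, measure_ne_top _ _⟩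
  exact ge_of_tendsto' ht fun n =>
    (measure_mono fun y hy => (hrq n).2.trans_le hy).trans (h (r n))

lemma measure_upperSet_le_of_Ioi {κ₁ κ₂ : Measure ℝ≥0} [IsFiniteMeasure κ₂]
    (h : ∀ q, κ₁ (Ioi q) ≤ κ₂ (Ioi q)) (huniv : κ₁ univ = κ₂ univ) {A : Set ℝ≥0}
    (hA : IsUpperSet A) : κ₁ A ≤ κ₂ A := by
  rcases A.eq_empty_or_nonempty with rfl | hne
  · simp
  by_cases hmem : sInf A ∈ A
  · have hAI : A = Ici (sInf A) :=
      Subset.antisymm (fun y hy => csInf_le (OrderBot.bddBelow A) hy) fun y hy => hA hy hmem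
    rcases eq_or_lt_of_le (zero_le (a := sInf A)) with h0 | h0
    · have : A = univ := by
        rw [hAI, ← h0]; ext; simp
      rw [this, huniv]
    · rw [hAI]
      exact measure_Ici_le_of_Ioi h h0
  · have hAI : A = Ioi (sInf A) := by
      refine Subset.antisymm (fun y hy => lt_of_le_of_ne (csInf_le (OrderBot.bddBelow A) hy) ?_)
        fun y hy => ?_
      · rintro rfl; exact hmem hy
      · obtain ⟨z, hz, hzy⟩ := exists_lt_of_csInf_lt hne hy
        exact hA hzy.le hz
    rw [hAI]
    exact h _

/-- A stochastically smaller law gives a larger integral to a decreasing function. -/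
lemma lintegral_antitone_le_of_Ioi {κ₁ κ₂ : Measure ℝ≥0} [IsFiniteMeasure κ₁] [IsFiniteMeasure κ₂]
    (h : ∀ q, κ₁ (Ioi q) ≤ κ₂ (Ioi q)) (huniv : κ₁ univ = κ₂ univ) {φ : ℝ≥0 → ℝ≥0∞}
    (hφ : Antitone φ) (hφ1 : ∀ y, φ y ≤ 1) : ∫⁻ y, φ y ∂κ₂ ≤ ∫⁻ y, φ y ∂κ₁ := by
  have hne : ∀ y, φ y ≠ ⊤ := fun y => ((hφ1 y).trans_lt ENNReal.one_lt_top).ne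
  have hanti : Antitone fun y => (φ y).toReal :=
    fun y z hyz => ENNReal.toReal_mono (hne _) (hφ hyz)
  have hcake : ∀ κ : Measure ℝ≥0, ∫⁻ y, φ y ∂κ = ∫⁻ r in Ioi (0 : ℝ), κ {y | r < (φ y).toReal} := by
    intro κ
    rw [← lintegral_eq_lintegral_meas_lt κ (Eventually.of_forall fun y => ENNReal.toReal_nonneg)
      hanti.measurable.aemeasurable]
    simp only [ENNReal.ofReal_toReal (hne _)]
  rw [hcake, hcake]
  refine lintegral_mono fun r => ?_
  have hm : MeasurableSet {y | r < (φ y).toReal} :=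
    measurableSet_lt measurable_const hanti.measurable
  have hup : IsUpperSet {y | r < (φ y).toReal}ᶜ := by
    intro y z hyz hy
    simp only [mem_compl_iff, mem_ofPred_eq, not_lt] at hy ⊢
    exact (hanti hyz).trans hy
  have hc := measure_upperSet_le_of_Ioi h huniv hup
  rw [measure_compl hm (measure_ne_top _ _), measure_compl hm (measure_ne_top _ _), huniv] at hc
  exact (ENNReal.sub_le_sub_iff_left (measure_mono (subset_univ _)) (measure_ne_top _ _)).1
    hc

/-- For a New-Better-than-Used law, the residual service time of a service that has lasted longer
than `τ` is stochastically smaller than a fresh service time. -/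
lemma lintegral_residual_ge {μ : Measure ℝ≥0} [IsProbabilityMeasure μ]
    (hμ : ∀ τ q, μ (Ioi (τ + q)) ≤ μ (Ioi τ) * μ (Ioi q)) {φ : ℝ≥0 → ℝ≥0∞}
    (hφ : Antitone φ) (hφ1 : ∀ y, φ y ≤ 1) (τ : ℝ≥0) :
    μ (Ioi τ) * ∫⁻ y, φ y ∂μ ≤ ∫⁻ y in Ioi τ, φ (y - τ) ∂μ := by
  have hsub : Measurable fun y : ℝ≥0 => y - τ := by fun_prop
  have hκ : ∀ A, MeasurableSet A →
      ((μ.restrict (Ioi τ)).map fun y => y - τ) A = μ {y | y - τ ∈ A ∧ τ < y} := by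
    intro A hA
    rw [Measure.map_apply hsub hA, Measure.restrict_apply (hsub hA)]
    rfl
  rw [← lintegral_map hφ.measurable hsub, ← smul_eq_mul, ← lintegral_smul_measure]
  have : IsFiniteMeasure (μ (Ioi τ) • μ) := Measure.smul_finite _ (measure_ne_top _ _)
  have : IsFiniteMeasure ((μ.restrict (Ioi τ)).map fun y => y - τ) := inferInstance
  refine lintegral_antitone_le_of_Ioi (fun q => ?_) ?_ hφ hφ1
  · rw [hκ _ measurableSet_Ioi, Measure.smul_apply, smul_eq_mul]
    refine (measure_mono fun y hy => ?_).trans (hμ τ q)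
    simpa [lt_tsub_iff_left] using hy.1
  · rw [hκ _ .univ, Measure.smul_apply, measure_univ, smul_eq_mul, mul_one]
    congr 1
    ext; simp

/-! ### Completions of permanently busy servers -/

/-- The number of services that a server which becomes free at time `b` completes by time `t` if it
is kept busy with services of durations `y 0, y 1, …`. -/
noncomputable def renewals (t b : ℝ≥0∞) (y : ℕ → ℝ≥0) : ℝ≥0∞ :=
  ∑' j, if b + ∑ i ∈ Finset.range (j + 1), (y i : ℝ≥0∞) ≤ t then 1 else 0

lemma renewals_eq_add (t b : ℝ≥0∞) (y : ℕ → ℝ≥0) :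
    renewals t b y =
      (if b + y 0 ≤ t then 1 else 0) + renewals t (b + y 0) (fun j => y (j + 1)) := by
  rw [renewals, tsum_eq_zero_add' ENNReal.summable, renewals]
  congr 1
  · simp
  · refine tsum_congr fun j => ?_
    rw [Finset.sum_range_succ' _ (j + 1), add_comm (∑ i ∈ _, _) _, add_assoc]

lemma renewals_anti (t : ℝ≥0∞) {b b' : ℝ≥0∞} (h : b ≤ b') (y : ℕ → ℝ≥0) :
    renewals t b' y ≤ renewals t b y := by
  refine ENNReal.tsum_le_tsum fun j => ?_
  split_ifs with h1 h2
  · exact le_rfl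
  · exact absurd ((add_le_add_left h _).trans h1) h2
  · exact zero_le
  · exact le_rfl

lemma renewals_eq_zero {t b : ℝ≥0∞} (h : t < b) (y : ℕ → ℝ≥0) : renewals t b y = 0 := by
  rw [renewals, ENNReal.tsum_eq_zero]
  exact fun j => if_neg (h.trans_le le_self_add).not_ge

lemma measurable_renewals (t : ℝ≥0∞) :
    Measurable fun z : ℝ≥0∞ × (ℕ → ℝ≥0) => renewals t z.1 z.2 := by
  refine Measurable.tsum fun j => Measurable.ite (measurableSet_le ?_ measurable_const)
    measurable_const measurable_const
  fun_prop

/-- A state of `M` servers: how many services have been completed, and the time at which each server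
becomes free. -/
abbrev ServerState (M : ℕ) := ℕ × (Fin M → ℝ≥0∞)

variable {M : ℕ}

/-- Server `m` works until time `e`; the service is counted if `e ≤ t`. -/
noncomputable def ServerState.workUntil (t : ℝ≥0∞) (σ : ServerState M) (m : Fin M) (e : ℝ≥0∞) :
    ServerState M :=
  (σ.1 + if e ≤ t then 1 else 0, Function.update σ.2 m e)

/-- The probability that at least `c` services are completed by time `t` if from the state `σ` on
all servers are permanently busy with i.i.d. services of law `μ`. -/
noncomputable def reach (μ : Measure ℝ≥0) (t : ℝ≥0∞) (c : ℕ) (σ : ServerState M) : ℝ≥0∞ :=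
  Measure.infinitePi (fun _ : Fin M × ℕ => μ)
    {ω | (c : ℝ≥0∞) ≤ σ.1 + ∑ m, renewals t (σ.2 m) fun j => ω (m, j)}

lemma measurableSet_reach (t : ℝ≥0∞) (c : ℕ) :
    MeasurableSet {z : ServerState M × (Fin M × ℕ → ℝ≥0) |
      (c : ℝ≥0∞) ≤ z.1.1 + ∑ m, renewals t (z.1.2 m) fun j => z.2 (m, j)} := by
  refine measurableSet_le measurable_const (Measurable.fun_add ?_
    (Finset.measurable_fun_sum _ fun m _ => ?_))
  · exact (measurable_from_top (f := fun n : ℕ => (n : ℝ≥0∞))).comp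
      (measurable_fst.comp measurable_fst)
  · exact (measurable_renewals t).comp (f := fun z : ServerState M × (Fin M × ℕ → ℝ≥0) =>
      (z.1.2 m, fun j => z.2 (m, j))) (by fun_prop)

variable (μ : Measure ℝ≥0) (t : ℝ≥0∞) (c : ℕ)

lemma reach_mono {σ σ' : ServerState M} (h1 : σ.1 ≤ σ'.1) (h2 : σ'.2 ≤ σ.2) :
    reach μ t c σ ≤ reach μ t c σ' := by
  refine measure_mono fun ω hω => le_trans (Set.mem_ofPred_eq ▸ hω) ?_
  gcongr with m
  exact renewals_anti t (h2 m) _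

lemma reach_eq_zero {σ : ServerState M} (h : σ.1 < c) (hb : ∀ m, t < σ.2 m) :
    reach μ t c σ = 0 := by
  have : {ω : Fin M × ℕ → ℝ≥0 |
      (c : ℝ≥0∞) ≤ σ.1 + ∑ m, renewals t (σ.2 m) fun j => ω (m, j)} = ∅ := by
    refine eq_empty_of_forall_notMem fun ω hω => ?_
    simp only [renewals_eq_zero (hb _), Finset.sum_const_zero, add_zero, mem_ofPred_eq,
      Nat.cast_le] at hω
    omega
  rw [reach, this, measure_empty]

/-- Ending a service later never helps, whether or not it is counted. -/
lemma reach_workUntil_anti (σ : ServerState M) (m : Fin M) :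
    Antitone fun e => reach μ t c (σ.workUntil t m e) := by
  intro e e' h
  refine reach_mono μ t c ?_ ?_
  · simp only [ServerState.workUntil]
    gcongr
    split_ifs with h1 h2 <;> first | exact le_rfl | exact absurd (h.trans h1) h2 | simp
  · exact update_le_update_iff.2 ⟨h, fun _ _ => le_rfl⟩

variable [IsProbabilityMeasure μ]

lemma measurable_reach : Measurable (reach (M := M) μ t c) :=
  measurable_measure_prodMk_left (measurableSet_reach t c)

lemma reach_le_one (σ : ServerState M) : reach μ t c σ ≤ 1 := prob_le_one

lemma reach_eq_one {σ : ServerState M} (h : c ≤ σ.1) : reach μ t c σ = 1 := by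
  rw [reach, ← measure_univ (μ := Measure.infinitePi (fun _ : Fin M × ℕ => μ))]
  congr 1
  refine eq_univ_of_forall fun ω => ?_
  have hc : (c : ℝ≥0∞) ≤ σ.1 := by exact_mod_cast h
  exact hc.trans le_self_add

/-- The first service of any one of the servers can be drawn separately. -/
lemma reach_eq_lintegral (σ : ServerState M) (m : Fin M) :
    reach μ t c σ = ∫⁻ y, reach μ t c (σ.workUntil t m (σ.2 m + y)) ∂μ := by
  let f : Fin M × ℕ → Option (Fin M × ℕ) := fun p =>
    if p.1 = m then (if p.2 = 0 then none else some (m, p.2 - 1)) else some p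
  have hf : Function.Injective f := by
    rintro ⟨i, j⟩ ⟨i', j'⟩ h
    simp only [f] at h
    by_cases hi : i = m <;> by_cases hi' : i' = m <;> by_cases hj : j = 0 <;>
      by_cases hj' : j' = 0 <;> (simp_all; try omega)
  have hm : Measurable fun (z : ℝ≥0 × (Fin M × ℕ → ℝ≥0)) k => (f k).elim z.1 z.2 := by
    refine measurable_pi_lambda _ fun k => ?_
    cases f k with
    | none => exact measurable_fst
    | some i => exact (measurable_pi_apply i).comp measurable_snd
  have hS := (measurable_prodMk_left (x := σ)) (measurableSet_reach t c)
  rw [reach]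
  conv_lhs => rw [← map_optionElim_comp_infinitePi μ hf]
  refine (Measure.map_apply hm hS).trans ((Measure.prod_apply (hm hS)).trans ?_)
  refine lintegral_congr fun y => ?_
  rw [reach]
  congr 1
  ext ω
  simp only [mem_preimage, mem_ofPred_eq, ServerState.workUntil]
  have hsum : ∑ i, renewals t (σ.2 i) (fun j => (f (i, j)).elim y ω) =
      (if σ.2 m + y ≤ t then 1 else 0) +
        ∑ i, renewals t (Function.update σ.2 m (σ.2 m + y) i) (fun j => ω (i, j)) := by
    rw [Fintype.sum_eq_add_sum_compl m, Fintype.sum_eq_add_sum_compl m, renewals_eq_add]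
    have h0 : (f (m, 0)).elim y ω = y := by simp [f]
    have h1 : ∀ j, (f (m, j + 1)).elim y ω = ω (m, j) := by simp [f]
    simp only [h0, h1, Function.update_self, add_assoc]
    congr 2
    refine Finset.sum_congr rfl fun i hi => ?_
    have him : i ≠ m := by simpa using hi
    simp [f, him]
  rw [hsum, ← add_assoc]
  push_cast
  rfl

/-- A server that is serving a New-Better-than-Used service begun before time `a` does at least as
well as a server that starts a fresh service at time `a`. -/
lemma reach_le_lintegral_residual (hμ : ∀ τ q, μ (Ioi (τ + q)) ≤ μ (Ioi τ) * μ (Ioi q))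
    (σ : ServerState M) (m : Fin M) {s a : ℝ≥0} (hsa : s ≤ a) (hσ : (a : ℝ≥0∞) ≤ σ.2 m) :
    reach μ t c σ ≤
      ∫⁻ y, (if (s + y : ℝ≥0∞) ≤ a then reach μ t c σ
        else reach μ t c (σ.workUntil t m (s + y))) ∂μ := by
  set φ : ℝ≥0 → ℝ≥0∞ := fun r => reach μ t c (σ.workUntil t m (a + r)) with hφd
  have hφ : Antitone φ := fun r r' h => reach_workUntil_anti μ t c σ m (by gcongr)
  have hφσ : reach μ t c σ ≤ ∫⁻ y, φ y ∂μ := by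
    have h := reach_eq_lintegral μ t c (σ.1, Function.update σ.2 m a) m
    simp only [ServerState.workUntil, Function.update_self, Function.update_idem] at h
    have hle : Function.update σ.2 m (a : ℝ≥0∞) ≤ σ.2 := update_le_iff.2 ⟨hσ, fun _ _ => le_rfl⟩
    exact (reach_mono μ t c (σ := σ) (σ' := (σ.1, Function.update σ.2 m a)) le_rfl hle).trans h.le
  obtain ⟨τ, rfl⟩ := exists_add_of_le hsa
  rw [← lintegral_add_compl _ (measurableSet_Ioi (a := τ))]
  have h1 : μ (Ioi τ) * reach μ t c σ ≤ ∫⁻ y in Ioi τ, (if (s + y : ℝ≥0∞) ≤ (s + τ : ℝ≥0)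
      then reach μ t c σ else reach μ t c (σ.workUntil t m (s + y))) ∂μ := by
    refine (mul_le_mul_right hφσ _).trans ((lintegral_residual_ge hμ hφ
      (fun y => reach_le_one _ _ _ _) τ).trans_eq ?_)
    refine setLIntegral_congr_fun measurableSet_Ioi fun y hy => ?_
    have hy' : τ < y := hy
    have hn : ¬ ((s : ℝ≥0∞) + y ≤ (s + τ : ℝ≥0)) := by
      norm_cast
      exact not_le.2 (add_lt_add_right hy' s)
    simp only [hn, if_false, hφd]
    congr 2
    norm_cast
    rw [add_assoc, add_tsub_cancel_of_le hy'.le]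
  have h2 : μ (Ioi τ)ᶜ * reach μ t c σ = ∫⁻ y in (Ioi τ)ᶜ, (if (s + y : ℝ≥0∞) ≤ (s + τ : ℝ≥0)
      then reach μ t c σ else reach μ t c (σ.workUntil t m (s + y))) ∂μ := by
    rw [mul_comm, ← setLIntegral_const]
    refine setLIntegral_congr_fun measurableSet_Ioi.compl fun y hy => ?_
    have hy' : y ≤ τ := not_lt.1 hy
    have : (s : ℝ≥0∞) + y ≤ (s + τ : ℝ≥0) := by norm_cast; gcongr
    exact (if_pos this).symm
  refine le_trans (le_of_eq ?_) (add_le_add h1 h2.le)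
  rw [← add_mul, measure_add_measure_compl measurableSet_Ioi, measure_univ, one_mul]

lemma exists_coe_eq {e : ℝ≥0∞} (h : e ≠ ⊤) : ∃ τ : ℝ≥0, (τ : ℝ≥0∞) = e :=
  ⟨e.toNNReal, ENNReal.coe_toNNReal h⟩

/-! ### Running the services of a policy one at a time -/

namespace Policy

variable {N M : ℕ} {I : Traffic N} {𝒰 : Type*} [MeasurableSpace 𝒰] (π : Policy M I 𝒰)

lemma start_update (u : 𝒰) (x : ℕ → ℝ≥0) {j k : ℕ} (hjk : j ≤ k) (y : ℝ≥0) :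
    π.start u (Function.update x k y) j = π.start u x j :=
  (π.causal u x _ j fun _ hi => Or.inl
    (Function.update_of_ne (hi.trans_le hjk).ne y x).symm).1

lemma packet_update (u : 𝒰) (x : ℕ → ℝ≥0) {j k : ℕ} (hjk : j ≤ k) (y : ℝ≥0)
    (h : π.start u x j ≠ ⊤) : π.packet u (Function.update x k y) j = π.packet u x j :=
  ((π.causal u x _ j fun _ hi => Or.inl
    (Function.update_of_ne (hi.trans_le hjk).ne y x).symm).2 h).1

lemma server_update (u : 𝒰) (x : ℕ → ℝ≥0) {j k : ℕ} (hjk : j ≤ k) (y : ℝ≥0)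
    (h : π.start u x j ≠ ⊤) : π.server u (Function.update x k y) j = π.server u x j :=
  ((π.causal u x _ j fun _ hi => Or.inl
    (Function.update_of_ne (hi.trans_le hjk).ne y x).symm).2 h).2

/-- The time at which the `k`-th service ends. -/
noncomputable def finish (u : 𝒰) (x : ℕ → ℝ≥0) (k : ℕ) : ℝ≥0∞ := π.start u x k + x k

lemma start_le_finish (u : 𝒰) (x : ℕ → ℝ≥0) (k : ℕ) : π.start u x k ≤ π.finish u x k :=
  le_self_add

/-- Only finitely many services can start in a bounded time interval, and their number is bounded
uniformly in the service times, because only finitely many packets arrive. -/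
lemma exists_start_bound (I : Traffic N) (t : ℝ≥0) :
    ∃ K : ℕ, ∀ (π : Policy M I 𝒰) (u : 𝒰) (x : ℕ → ℝ≥0) (k : ℕ), π.start u x k ≤ t → k < K := by
  have hfin : {p : Packet N | I.arr p.1 p.2 ≤ t}.Finite := by
    have : {p : Packet N | I.arr p.1 p.2 ≤ t} ⊆ ⋃ n, Prod.mk n '' {i | I.arr n i ≤ t} := by
      rintro ⟨n, i⟩ h
      exact mem_iUnion.2 ⟨n, i, h, rfl⟩
    exact (finite_iUnion fun n => (I.finite_arr n t).image _).subset this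
  refine ⟨hfin.toFinset.card, fun π u x k hk => ?_⟩
  have hlt : ∀ j ≤ k, π.start u x j ≤ t := fun j hj => (π.start_mono u x hj).trans hk
  have hne : ∀ j ≤ k, π.start u x j ≠ ⊤ := fun j hj =>
    ((hlt j hj).trans_lt ENNReal.coe_lt_top).ne
  have := Finset.card_le_card_of_injOn (s := Finset.range (k + 1)) (t := hfin.toFinset)
    (π.packet u x) ?_ ?_
  · simpa using this
  · intro j hj
    have hj' : j ≤ k := by simpa [Nat.lt_succ_iff] using hj
    simpa using (π.arrived u x j (hne j hj')).trans (hlt j hj')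
  · intro i hi j hj hij
    have hi' : i ≤ k := by simpa [Nat.lt_succ_iff] using hi
    have hj' : j ≤ k := by simpa [Nat.lt_succ_iff] using hj
    rcases lt_trichotomy i j with h | h | h
    · exact absurd hij (π.served_once u x i j h (hne j hj'))
    · exact h
    · exact absurd hij.symm (π.served_once u x j i h (hne i hi'))

/-- The server state after the first `k` services, when a service of duration `y` that starts at time
`s` on server `m` changes the state `σ` into `step σ s m y`. -/
noncomputable def run (step : ServerState M → ℝ≥0∞ → Fin M → ℝ≥0 → ServerState M)
    (σ₀ : ServerState M) (u : 𝒰) (x : ℕ → ℝ≥0) : ℕ → ServerState M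
  | 0 => σ₀
  | k + 1 => step (run step σ₀ u x k) (π.start u x k) (π.server u x k) (x k)

variable {step : ServerState M → ℝ≥0∞ → Fin M → ℝ≥0 → ServerState M} {σ₀ : ServerState M}

lemma run_update (htop : ∀ σ m y, step σ ⊤ m y = σ) (u : 𝒰) (x : ℕ → ℝ≥0) {j k : ℕ} (hjk : j ≤ k)
    (y : ℝ≥0) : π.run step σ₀ u (Function.update x k y) j = π.run step σ₀ u x j := by
  induction j with
  | zero => rfl
  | succ j ih =>
    have hj : j ≤ k := (Nat.le_succ j).trans hjk
    simp only [run]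
    rw [ih hj, π.start_update u x hj, Function.update_of_ne (Nat.lt_of_succ_le hjk).ne]
    by_cases h : π.start u x j = ⊤
    · rw [h, htop, htop]
    · rw [π.server_update u x hj y h]

lemma measurable_run
    (hstep : Measurable fun z : ServerState M × ℝ≥0∞ × Fin M × ℝ≥0 => step z.1 z.2.1 z.2.2.1 z.2.2.2)
    (u : 𝒰) (k : ℕ) : Measurable fun x => π.run step σ₀ u x k := by
  induction k with
  | zero => exact measurable_const
  | succ k ih =>
    refine hstep.comp (ih.prodMk (Measurable.prodMk ?_ (Measurable.prodMk ?_ ?_)))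
    · exact (π.measurable_start k).comp measurable_prodMk_left
    · exact (π.measurable_server k).comp measurable_prodMk_left
    · exact measurable_pi_apply k

variable {μ : Measure ℝ≥0} [IsProbabilityMeasure μ] {t : ℝ≥0∞} {c : ℕ}

/-- The `k`-th service time may be redrawn when the `k`-th service is taken into account, since the
earlier decisions and the `k`-th decision do not depend on it. -/
lemma lintegral_reach_run_succ (htop : ∀ σ m y, step σ ⊤ m y = σ)
    (hstep : Measurable fun z : ServerState M × ℝ≥0∞ × Fin M × ℝ≥0 => step z.1 z.2.1 z.2.2.1 z.2.2.2)
    (u : 𝒰) (k : ℕ) :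
    ∫⁻ x, reach μ t c (π.run step σ₀ u x (k + 1)) ∂(Measure.infinitePi fun _ : ℕ => μ) =
      ∫⁻ x, ∫⁻ y, reach μ t c (step (π.run step σ₀ u x k) (π.start u x k) (π.server u x k) y) ∂μ
        ∂(Measure.infinitePi fun _ : ℕ => μ) := by
  refine (lintegral_update_infinitePi μ k ((measurable_reach μ t c).comp
    (π.measurable_run (σ₀ := σ₀) hstep u (k + 1)))).trans ?_
  refine lintegral_congr fun x => lintegral_congr fun y => ?_
  simp only [run, Function.comp]
  rw [π.run_update htop u x le_rfl, π.start_update u x le_rfl, Function.update_self]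
  by_cases h : π.start u x k = ⊤
  · rw [h, htop, htop]
  · rw [π.server_update u x le_rfl y h]

/-- A step that does not increase `reach` on average makes it a supermartingale along the run. -/
lemma lintegral_reach_run_le (htop : ∀ σ m y, step σ ⊤ m y = σ)
    (hstep : Measurable fun z : ServerState M × ℝ≥0∞ × Fin M × ℝ≥0 => step z.1 z.2.1 z.2.2.1 z.2.2.2)
    (u : 𝒰) (h : ∀ k x, ∫⁻ y, reach μ t c
      (step (π.run step σ₀ u x k) (π.start u x k) (π.server u x k) y) ∂μ ≤
        reach μ t c (π.run step σ₀ u x k)) (k : ℕ) :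
    ∫⁻ x, reach μ t c (π.run step σ₀ u x k) ∂(Measure.infinitePi fun _ : ℕ => μ) ≤
      reach μ t c σ₀ := by
  induction k with
  | zero => simp [run]
  | succ k ih =>
    rw [lintegral_reach_run_succ π htop hstep]
    exact (lintegral_mono fun x => h k x).trans ih

/-- A step that does not decrease `reach` on average makes it a submartingale along the run. -/
lemma le_lintegral_reach_run (htop : ∀ σ m y, step σ ⊤ m y = σ)
    (hstep : Measurable fun z : ServerState M × ℝ≥0∞ × Fin M × ℝ≥0 => step z.1 z.2.1 z.2.2.1 z.2.2.2)
    (u : 𝒰) (h : ∀ k x, reach μ t c (π.run step σ₀ u x k) ≤ ∫⁻ y, reach μ t c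
      (step (π.run step σ₀ u x k) (π.start u x k) (π.server u x k) y) ∂μ) (k : ℕ) :
    reach μ t c σ₀ ≤
      ∫⁻ x, reach μ t c (π.run step σ₀ u x k) ∂(Measure.infinitePi fun _ : ℕ => μ) := by
  induction k with
  | zero => simp [run]
  | succ k ih =>
    rw [lintegral_reach_run_succ π htop hstep]
    exact ih.trans (lintegral_mono fun x => h k x)

end Policy

lemma measurable_workUntil (t : ℝ≥0∞) :
    Measurable fun z : ServerState M × Fin M × ℝ≥0∞ => z.1.workUntil t z.2.1 z.2.2 := by
  unfold ServerState.workUntil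
  refine Measurable.prodMk ?_ ?_
  · exact (measurable_fst.comp measurable_fst).add (Measurable.ite
      (measurableSet_le (measurable_snd.comp measurable_snd) measurable_const)
      measurable_const measurable_const)
  · refine measurable_pi_lambda _ fun i => ?_
    simp only [Function.update_apply]
    refine Measurable.ite (measurableSet_eq_fun measurable_const
      (measurable_fst.comp measurable_snd)) (measurable_snd.comp measurable_snd) ?_
    exact (measurable_pi_apply i).comp (measurable_snd.comp measurable_fst)

/-! ### Completions within a time window, for an arbitrary policy -/

/-- A service that starts in `[a, t]` is moved forward to the time at which its server becomes free;
all other services are ignored. -/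
noncomputable def packedStep {M : ℕ} (t a : ℝ≥0) (σ : ServerState M) (s : ℝ≥0∞) (m : Fin M)
    (y : ℝ≥0) : ServerState M :=
  if s < a ∨ t < s then σ else σ.workUntil t m (σ.2 m + y)

namespace Policy

variable {N M : ℕ} {I : Traffic N} {𝒰 : Type*} [MeasurableSpace 𝒰] (π : Policy M I 𝒰)

lemma measurable_packedStep (t a : ℝ≥0) :
    Measurable fun z : ServerState M × ℝ≥0∞ × Fin M × ℝ≥0 =>
      packedStep t a z.1 z.2.1 z.2.2.1 z.2.2.2 := by
  have hs : Measurable fun z : ServerState M × ℝ≥0∞ × Fin M × ℝ≥0 => z.2.1 := by fun_prop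
  have hb : Measurable fun z : ServerState M × ℝ≥0∞ × Fin M × ℝ≥0 => z.1.2 z.2.2.1 := by
    have : Measurable fun w : Fin M × (Fin M → ℝ≥0∞) => w.2 w.1 :=
      measurable_from_prod_countable_right fun m => measurable_pi_apply m
    exact this.comp (f := fun z : ServerState M × ℝ≥0∞ × Fin M × ℝ≥0 => (z.2.2.1, z.1.2))
      (by fun_prop)
  refine Measurable.ite ((measurableSet_lt hs measurable_const).union
    (measurableSet_lt measurable_const hs)) measurable_fst ?_
  exact (measurable_workUntil (t : ℝ≥0∞)).comp (measurable_fst.prodMk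
    ((by fun_prop : Measurable fun z : ServerState M × ℝ≥0∞ × Fin M × ℝ≥0 => z.2.2.1).prodMk
      (hb.add (by fun_prop : Measurable fun z : ServerState M × ℝ≥0∞ × Fin M × ℝ≥0 =>
        (z.2.2.2 : ℝ≥0∞)))))

/-- The packed server state counts at least the actual completions in `[a, t]`, since each server
becomes free no later than it actually does. -/
lemma packed_invariant (t a : ℝ≥0) (u : 𝒰) (x : ℕ → ℝ≥0) (k : ℕ) :
    ((Finset.range k).filter fun j => a ≤ π.start u x j ∧ π.finish u x j ≤ t).card ≤
        (π.run (packedStep t a) (0, fun _ => a) u x k).1 ∧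
      ∀ m, (π.run (packedStep t a) (0, fun _ => a) u x k).2 m = a ∨
        ∃ j < k, π.server u x j = m ∧
          (π.run (packedStep t a) (0, fun _ => a) u x k).2 m ≤ π.finish u x j := by
  induction k with
  | zero => simp [run]
  | succ k ih =>
    obtain ⟨ih1, ih2⟩ := ih
    set σ := π.run (packedStep t a) (0, fun _ => a) u x k with hσ
    have hrun : π.run (packedStep t a) (0, fun _ => a) u x (k + 1) =
      packedStep t a σ (π.start u x k) (π.server u x k) (x k) := rfl
    rw [hrun, packedStep, Finset.range_add_one, Finset.filter_insert]
    by_cases hc : π.start u x k < a ∨ t < π.start u x k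
    · rw [if_pos hc, if_neg]
      · exact ⟨ih1, fun m => (ih2 m).imp_right fun ⟨j, hj, h⟩ => ⟨j, hj.trans (Nat.lt_succ_self k), h⟩⟩
      · rintro ⟨h1, h2⟩
        exact hc.elim (fun h => h.not_ge h1)
          fun h => h.not_ge ((π.start_le_finish u x k).trans h2)
    · rw [if_neg hc]
      push Not at hc
      set m := π.server u x k with hm
      have hfree : σ.2 m ≤ π.start u x k := by
        rcases ih2 m with h | ⟨j, hj, hjm, h⟩
        · rw [h]; exact hc.1
        · exact h.trans (π.server_free u x j k hj (hc.2.trans_lt ENNReal.coe_lt_top).ne hjm)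
      have hend : σ.2 m + x k ≤ π.finish u x k := by unfold finish; gcongr
      simp only [ServerState.workUntil]
      refine ⟨?_, fun i => ?_⟩
      · split_ifs with h1 h2
        · rw [Finset.card_insert_of_notMem (by simp)]
          omega
        · exact absurd (hend.trans h1.2) h2
        · omega
        · omega
      · by_cases hi : i = m
        · subst hi
          exact Or.inr ⟨k, Nat.lt_succ_self k, rfl, by rw [Function.update_self]; exact hend⟩
        · rw [Function.update_of_ne hi]
          exact (ih2 i).imp_right fun ⟨j, hj, h⟩ => ⟨j, hj.trans (Nat.lt_succ_self k), h⟩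

/-- Under every policy, the number of services that start and end in `[a, t]` is stochastically
smaller than the number of completions of permanently busy servers. -/
lemma measure_completions_le (μ : Measure ℝ≥0) [IsProbabilityMeasure μ] (t a : ℝ≥0) (c K : ℕ)
    (u : 𝒰) :
    Measure.infinitePi (fun _ : ℕ => μ) {x | c ≤
      ((Finset.range K).filter fun j => a ≤ π.start u x j ∧ π.finish u x j ≤ t).card} ≤
      reach (M := M) μ t c (0, fun _ => a) := by
  refine le_trans ?_ (π.lintegral_reach_run_le (step := packedStep t a) (fun σ m y => ?_)
    (measurable_packedStep t a) u (fun k x => ?_) K)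
  · refine le_trans (measure_mono fun x hx => ?_) (le_trans (le_of_eq (one_mul _).symm)
      (mul_meas_ge_le_lintegral ((measurable_reach μ (t : ℝ≥0∞) c).comp
        (π.measurable_run (measurable_packedStep t a) u K)) 1))
    exact (reach_eq_one μ t c (le_trans hx (π.packed_invariant t a u x K).1)).ge
  · simp [packedStep]
  · unfold packedStep
    split_ifs with h
    · simp
    · exact (reach_eq_lintegral μ t c _ _).ge

end Policy

/-! ### Starts within a time window, for a busy system -/

/-- A service that is in progress at time `a` or starts in `[a, t]` keeps its server busy; services
that end by time `a` are ignored. A service that starts in `[a, t]` is moved forward to the time at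
which its server becomes free. -/
noncomputable def residualStep {M : ℕ} (t a : ℝ≥0) (σ : ServerState M) (s : ℝ≥0∞) (m : Fin M)
    (y : ℝ≥0) : ServerState M :=
  if t < s then σ else if a ≤ s then σ.workUntil t m (σ.2 m + y)
    else if s + y ≤ a then σ else σ.workUntil t m (s + y)

namespace Policy

variable {N M : ℕ} {I : Traffic N} {𝒰 : Type*} [MeasurableSpace 𝒰] (π : Policy M I 𝒰)

lemma measurable_residualStep (t a : ℝ≥0) :
    Measurable fun z : ServerState M × ℝ≥0∞ × Fin M × ℝ≥0 =>
      residualStep t a z.1 z.2.1 z.2.2.1 z.2.2.2 := by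
  have hs : Measurable fun z : ServerState M × ℝ≥0∞ × Fin M × ℝ≥0 => z.2.1 := by fun_prop
  have hy : Measurable fun z : ServerState M × ℝ≥0∞ × Fin M × ℝ≥0 => (z.2.2.2 : ℝ≥0∞) := by
    fun_prop
  have hm : Measurable fun z : ServerState M × ℝ≥0∞ × Fin M × ℝ≥0 => z.2.2.1 := by fun_prop
  have hb : Measurable fun z : ServerState M × ℝ≥0∞ × Fin M × ℝ≥0 => z.1.2 z.2.2.1 := by
    have : Measurable fun w : Fin M × (Fin M → ℝ≥0∞) => w.2 w.1 :=
      measurable_from_prod_countable_right fun m => measurable_pi_apply m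
    exact this.comp (f := fun z : ServerState M × ℝ≥0∞ × Fin M × ℝ≥0 => (z.2.2.1, z.1.2))
      (by fun_prop)
  refine Measurable.ite (measurableSet_lt measurable_const hs) measurable_fst
    (Measurable.ite (measurableSet_le measurable_const hs) ?_
      (Measurable.ite (measurableSet_le (hs.add hy) measurable_const) measurable_fst ?_))
  · exact (measurable_workUntil (t : ℝ≥0∞)).comp (measurable_fst.prodMk (hm.prodMk (hb.add hy)))
  · exact (measurable_workUntil (t : ℝ≥0∞)).comp (measurable_fst.prodMk (hm.prodMk (hs.add hy)))

lemma le_run_residualStep (t a : ℝ≥0) (u : 𝒰) (x : ℕ → ℝ≥0) (k : ℕ) (m : Fin M) :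
    a ≤ (π.run (residualStep t a) (0, fun _ => a) u x k).2 m := by
  induction k generalizing m with
  | zero => exact le_rfl
  | succ k ih =>
    simp only [run, residualStep]
    split_ifs with h1 h2 h3
    · exact ih m
    · by_cases hm : m = π.server u x k
      · subst hm
        simpa [ServerState.workUntil] using (ih _).trans le_self_add
      · simpa [ServerState.workUntil, Function.update_of_ne hm] using ih m
    · exact ih m
    · by_cases hm : m = π.server u x k
      · subst hm
        simpa [ServerState.workUntil] using (not_le.1 h3).le
      · simpa [ServerState.workUntil, Function.update_of_ne hm] using ih m

/-- All servers are busy throughout `[a, t]`. -/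
def BusyOn (t a : ℝ≥0) (u : 𝒰) (x : ℕ → ℝ≥0) : Prop :=
  ∀ τ : ℝ≥0, a ≤ τ → τ ≤ t → ∀ m, ∃ k, π.server u x k = m ∧ π.start u x k ≤ τ ∧
    τ < π.finish u x k

/-- In a busy system, moving services forward changes nothing: the server state counts the actual
completions, and records the actual times at which servers become free after `a`. -/
lemma residual_invariant {t a : ℝ≥0} {u : 𝒰} {x : ℕ → ℝ≥0} (hbusy : π.BusyOn t a u x) (k : ℕ) :
    (π.run (residualStep t a) (0, fun _ => a) u x k).1 = ((Finset.range k).filter fun j =>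
        (a ≤ π.start u x j ∨ a < π.finish u x j) ∧ π.finish u x j ≤ t).card ∧
      (∀ j < k, π.start u x j ≤ t → π.finish u x j ≤
        (π.run (residualStep t a) (0, fun _ => a) u x k).2 (π.server u x j)) ∧
      ∀ m, (π.run (residualStep t a) (0, fun _ => a) u x k).2 m = a ∨
        ∃ j < k, π.server u x j = m ∧
          (π.run (residualStep t a) (0, fun _ => a) u x k).2 m = π.finish u x j := by
  induction k with
  | zero => simp [run]
  | succ k ih =>
    obtain ⟨ih1, ih2, ih3⟩ := ih
    have hle := π.le_run_residualStep t a u x k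
    set σ := π.run (residualStep t a) (0, fun _ => a) u x k with hσ
    have hrun : π.run (residualStep t a) (0, fun _ => a) u x (k + 1) =
      residualStep t a σ (π.start u x k) (π.server u x k) (x k) := rfl
    rw [hrun]
    have hsucc : ∀ m, (σ.2 m = a ∨ ∃ j < k, π.server u x j = m ∧ σ.2 m = π.finish u x j) →
        σ.2 m = a ∨ ∃ j < k + 1, π.server u x j = m ∧ σ.2 m = π.finish u x j :=
      fun m => Or.imp_right fun ⟨j, hj, h⟩ => ⟨j, hj.trans (Nat.lt_succ_self k), h⟩
    -- The services that leave the state unchanged are those that start after `t` or end by `a`.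
    by_cases hskip : t < π.start u x k ∨ (π.start u x k < a ∧ π.finish u x k ≤ a)
    · have hst : residualStep t a σ (π.start u x k) (π.server u x k) (x k) = σ := by
        unfold residualStep
        rcases hskip with h | ⟨h1, h2⟩
        · rw [if_pos h]
        · rw [if_neg h1.not_ge]
          exact ite_eq_left_iff.2 fun _ => if_pos h2
      rw [hst, Finset.range_add_one, Finset.filter_insert, if_neg]
      · refine ⟨ih1, fun j hj hjt => ?_, fun m => hsucc m (ih3 m)⟩
        rcases Nat.lt_succ_iff_lt_or_eq.1 hj with h | rfl
        · exact ih2 j h hjt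
        · rcases hskip with h | ⟨_, h⟩
          · exact absurd hjt h.not_ge
          · exact h.trans (hle _)
      · rintro ⟨h1, h2⟩
        rcases hskip with h | ⟨h3, h4⟩
        · exact h.not_ge ((π.start_le_finish u x k).trans h2)
        · exact h1.elim h3.not_ge h4.not_gt
    · push Not at hskip
      obtain ⟨hst, hsa⟩ := hskip
      have hkt : π.start u x k ≠ ⊤ := (hst.trans_lt ENNReal.coe_lt_top).ne
      set m := π.server u x k with hm
      have hwork : residualStep t a σ (π.start u x k) m (x k) =
          σ.workUntil t m (π.finish u x k) := by
        unfold residualStep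
        rw [if_neg hst.not_gt]
        by_cases has : a ≤ π.start u x k
        · rw [if_pos has]
          -- In a busy system, the service starts as soon as its server becomes free.
          have hfree : σ.2 m ≤ π.start u x k := by
            rcases ih3 m with h | ⟨j, hj, hjm, h⟩
            · rw [h]; exact has
            · rw [h]; exact π.server_free u x j k hj hkt hjm
          have heq : σ.2 m = π.start u x k := by
            refine hfree.eq_of_not_lt fun hlt => ?_
            obtain ⟨τ, hτ⟩ := exists_coe_eq (hlt.trans_le le_top).ne
            rw [← hτ] at hlt
            obtain ⟨i, him, hi1, hi2⟩ := hbusy τ (by exact_mod_cast (hle m).trans hτ.ge)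
              (by exact_mod_cast (hlt.le.trans hst)) m
            rcases lt_or_ge i k with hik | hik
            · have := ih2 i hik (hi1.trans (hlt.le.trans hst))
              rw [him, ← hτ] at this
              exact hi2.not_ge this
            · exact hlt.not_ge ((π.start_mono u x hik).trans hi1)
          rw [heq]
          rfl
        · rw [if_neg has]
          exact if_neg (hsa (not_le.1 has)).not_ge
      rw [hwork, Finset.range_add_one, Finset.filter_insert]
      simp only [ServerState.workUntil]
      refine ⟨?_, fun j hj hjt => ?_, fun i => ?_⟩
      · have hcount : a ≤ π.start u x k ∨ a < π.finish u x k := by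
          rcases le_or_gt (a : ℝ≥0∞) (π.start u x k) with h | h
          · exact Or.inl h
          · exact Or.inr (hsa h)
        by_cases hf : π.finish u x k ≤ t
        · rw [if_pos hf, if_pos ⟨hcount, hf⟩, Finset.card_insert_of_notMem (by simp), ih1]
        · rw [if_neg hf, if_neg fun h => hf h.2, ih1, add_zero]
      · rcases Nat.lt_succ_iff_lt_or_eq.1 hj with h | rfl
        · by_cases hjm : π.server u x j = m
          · rw [hjm, Function.update_self]
            exact (π.server_free u x j k h hkt hjm).trans (π.start_le_finish u x k)
          · rw [Function.update_of_ne hjm]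
            exact ih2 j h hjt
        · rw [← hm, Function.update_self]
      · by_cases hi : i = m
        · subst hi
          exact Or.inr ⟨k, Nat.lt_succ_self k, rfl, Function.update_self ..⟩
        · rw [Function.update_of_ne hi]
          exact hsucc i (ih3 i)

/-- In a busy system, every completion in the time window is followed by a start in the time window
on the same server. -/
lemma card_completions_le_card_starts {t a : ℝ≥0} {u : 𝒰} {x : ℕ → ℝ≥0} (hbusy : π.BusyOn t a u x)
    {K : ℕ} (hK : ∀ k, π.start u x k ≤ t → k < K) :
    ((Finset.range K).filter fun j =>
        (a ≤ π.start u x j ∨ a < π.finish u x j) ∧ π.finish u x j ≤ t).card ≤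
      ((Finset.range K).filter fun j => a ≤ π.start u x j ∧ π.start u x j ≤ t).card := by
  classical
  have hex : ∀ j, ((a ≤ π.start u x j ∨ a < π.finish u x j) ∧ π.finish u x j ≤ t) →
      ∃ k, j < k ∧ π.server u x j = π.server u x k ∧
        a ≤ π.start u x k ∧ π.start u x k ≤ t ∧
        ∀ i, j < i → π.server u x j = π.server u x i → k ≤ i := by
    rintro j ⟨h1, h2⟩
    have ha : a ≤ π.finish u x j := h1.elim (fun h => h.trans (π.start_le_finish u x j)) le_of_lt
    obtain ⟨τ, hτ⟩ := exists_coe_eq (h2.trans_lt ENNReal.coe_lt_top).ne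
    obtain ⟨k, hk1, hk2, hk3⟩ := hbusy τ (by rw [← hτ] at ha; exact_mod_cast ha)
      (by rw [← hτ] at h2; exact_mod_cast h2) (π.server u x j)
    rw [hτ] at hk2 hk3
    have hjt : π.start u x j ≠ ⊤ :=
      ((π.start_le_finish u x j).trans_lt (h2.trans_lt ENNReal.coe_lt_top)).ne
    have hjk : j < k := by
      rcases lt_trichotomy j k with h | h | h
      · exact h
      · subst h; exact absurd hk3 (lt_irrefl _)
      · exact absurd ((π.server_free u x k j h hjt hk1).trans (π.start_le_finish u x j))
          hk3.not_ge
    have hn : ∃ k, j < k ∧ π.server u x j = π.server u x k := ⟨k, hjk, hk1.symm⟩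
    obtain ⟨hf1, hf2⟩ := Nat.find_spec hn
    have hfk : Nat.find hn ≤ k := Nat.find_min' hn ⟨hjk, hk1.symm⟩
    have hft : π.start u x (Nat.find hn) ≤ t := (π.start_mono u x hfk).trans (hk2.trans h2)
    exact ⟨Nat.find hn, hf1, hf2, ha.trans (π.server_free u x j _ hf1
      (hft.trans_lt ENNReal.coe_lt_top).ne hf2), hft, fun i hi1 hi2 => Nat.find_min' hn ⟨hi1, hi2⟩⟩
  choose! next hn1 hn2 hn3 hn4 hn5 using hex
  refine Finset.card_le_card_of_injOn next (fun j hj => ?_) fun i hi j hj hij => ?_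
  · have hj' := (Finset.mem_filter.1 hj).2
    simp only [Finset.coe_filter, Finset.mem_range, mem_ofPred_eq]
    exact ⟨hK _ (hn4 j hj'), hn3 j hj', hn4 j hj'⟩
  · have hi' := (Finset.mem_filter.1 hi).2
    have hj' := (Finset.mem_filter.1 hj).2
    have hs : π.server u x i = π.server u x j := by rw [hn2 i hi', hn2 j hj', hij]
    rcases lt_trichotomy i j with h | h | h
    · have := hn5 i hi' j h hs
      have := hn1 j hj'
      omega
    · exact h
    · have := hn5 j hj' i h hs.symm
      have := hn1 i hi'
      omega

/-- In a busy system, every server is occupied beyond time `t` once all services that start by time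
`t` are taken into account, so the final server state has no completions left to come. -/
lemma reach_run_residualStep_eq_zero {μ : Measure ℝ≥0} {t a : ℝ≥0} {u : 𝒰}
    {x : ℕ → ℝ≥0} (hbusy : π.BusyOn t a u x) {c K : ℕ} (hK : ∀ k, π.start u x k ≤ t → k < K)
    (hc : ((Finset.range K).filter fun j => a ≤ π.start u x j ∧ π.start u x j ≤ t).card < c) :
    reach μ t c (π.run (residualStep t a) (0, fun _ => a) u x K) = 0 := by
  obtain ⟨h1, h2, -⟩ := π.residual_invariant hbusy K
  refine reach_eq_zero μ t c ?_ fun m => ?_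
  · rw [h1]
    exact (π.card_completions_le_card_starts hbusy hK).trans_lt hc
  · by_contra! hm
    obtain ⟨τ, hτ⟩ := exists_coe_eq (hm.trans_lt ENNReal.coe_lt_top).ne
    rw [← hτ] at hm
    obtain ⟨i, him, hi1, hi2⟩ := hbusy τ
      (by exact_mod_cast (π.le_run_residualStep t a u x K m).trans hτ.ge) (by exact_mod_cast hm) m
    have := h2 i (hK i (hi1.trans hm)) (hi1.trans hm)
    rw [him, ← hτ] at this
    exact hi2.not_ge this

/-- For New-Better-than-Used service times, the number of services that start in `[a, t]` is
stochastically larger than the number of completions of permanently busy servers, up to the event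
that some server is idle at some time in `[a, t]`. -/
lemma le_measure_starts (μ : Measure ℝ≥0) [IsProbabilityMeasure μ]
    (hμ : ∀ τ q, μ (Ioi (τ + q)) ≤ μ (Ioi τ) * μ (Ioi q)) (t a : ℝ≥0) (c : ℕ) {K : ℕ} (u : 𝒰)
    (hK : ∀ x k, π.start u x k ≤ t → k < K) :
    reach (M := M) μ t c (0, fun _ => a) ≤ Measure.infinitePi (fun _ : ℕ => μ)
      {x | π.BusyOn t a u x → c ≤
        ((Finset.range K).filter fun j => a ≤ π.start u x j ∧ π.start u x j ≤ t).card} := by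
  refine (π.le_lintegral_reach_run (step := residualStep t a) (fun σ m y => ?_)
    (measurable_residualStep t a) u (fun k x => ?_) K).trans ?_
  · simp [residualStep]
  · set σ := π.run (residualStep t a) (0, fun _ => a) u x k with hσ
    unfold residualStep
    split_ifs with h1 h2
    · simp
    · exact (reach_eq_lintegral μ t c _ _).le
    · have h2' := not_le.1 h2
      obtain ⟨s, hs⟩ := exists_coe_eq (h2'.trans_le le_top).ne
      rw [← hs] at h2' ⊢
      refine (reach_le_lintegral_residual μ t c hμ σ (π.server u x k) (s := s) (a := a)
        (by exact_mod_cast h2'.le) (π.le_run_residualStep t a u x k _)).trans_eq ?_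
      refine lintegral_congr fun y => ?_
      split_ifs <;> rfl
  · refine le_trans (lintegral_mono fun x => ?_) (lintegral_indicator_one_le _)
    by_cases hx : π.BusyOn t a u x → c ≤
        ((Finset.range K).filter fun j => a ≤ π.start u x j ∧ π.start u x j ≤ t).card
    · rw [indicator_of_mem (by exact hx)]
      exact reach_le_one _ _ _ _
    · push Not at hx
      rw [π.reach_run_residualStep_eq_zero hx.1 (hK x) hx.2]
      exact zero_le

/-! ### Freshness levels -/

/-- The `k`-th service is given to a packet of flow `n` that was generated at time `v` or later. -/
def Refreshes (u : 𝒰) (x : ℕ → ℝ≥0) (n : Fin N) (v : ℝ) (k : ℕ) : Prop :=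
  (π.packet u x k).1 = n ∧ v ≤ I.gen n (π.packet u x k).2

lemma le_freshest_iff (δ : Fin N → ℝ≥0) (u : 𝒰) (x : ℕ → ℝ≥0) (n : Fin N) {K : Set ℕ}
    (hK : K.Finite) (v : ℝ) :
    v ≤ π.freshest δ u x n K ↔ v ≤ -(δ n : ℝ) ∨ ∃ k ∈ K, π.Refreshes u x n v k := by
  have hfin : (insert (-(δ n : ℝ))
      {s : ℝ | ∃ k ∈ K, (π.packet u x k).1 = n ∧ s = I.gen n (π.packet u x k).2}).Finite := by
    refine Finite.insert _ ((hK.image fun k => (I.gen n (π.packet u x k).2 : ℝ)).subset ?_)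
    rintro s ⟨k, hk, -, rfl⟩
    exact mem_image_of_mem _ hk
  constructor
  · intro h
    rcases (insert_nonempty _ _).csSup_mem hfin with hs | ⟨k, hk, hn, hs⟩
    · exact Or.inl (h.trans hs.le)
    · exact Or.inr ⟨k, hk, hn, h.trans hs.le⟩
  · rintro (h | ⟨k, hk, hn, h⟩)
    · exact h.trans (le_csSup hfin.bddAbove (mem_insert _ _))
    · exact h.trans (le_csSup hfin.bddAbove (mem_insert_of_mem _ ⟨k, hk, hn, rfl⟩))

/-- The services that have started by time `t`. -/
def started (u : 𝒰) (x : ℕ → ℝ≥0) (t : ℝ) : Set ℕ :=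
  {k | π.start u x k ≤ ENNReal.ofReal t}

/-- The services that have ended by time `t`. -/
def delivered (u : 𝒰) (x : ℕ → ℝ≥0) (t : ℝ) : Set ℕ :=
  {k | π.start u x k + x k ≤ ENNReal.ofReal t}

lemma delivered_subset_started (u : 𝒰) (x : ℕ → ℝ≥0) (t : ℝ) :
    π.delivered u x t ⊆ π.started u x t :=
  fun k hk => (π.start_le_finish u x k).trans hk

lemma finite_started (u : 𝒰) (x : ℕ → ℝ≥0) (t : ℝ) : (π.started u x t).Finite := by
  obtain ⟨K, hK⟩ := exists_start_bound (M := M) (𝒰 := 𝒰) I t.toNNReal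
  exact (finite_Iio K).subset fun k hk => hK π u x k hk

lemma finite_delivered (u : 𝒰) (x : ℕ → ℝ≥0) (t : ℝ) : (π.delivered u x t).Finite :=
  (π.finite_started u x t).subset (π.delivered_subset_started u x t)

lemma freshest_mono (δ : Fin N → ℝ≥0) (u : 𝒰) (x : ℕ → ℝ≥0) (n : Fin N) {K L : Set ℕ}
    (hL : L.Finite) (h : K ⊆ L) : π.freshest δ u x n K ≤ π.freshest δ u x n L := by
  rw [π.le_freshest_iff δ u x n hL]
  exact ((π.le_freshest_iff δ u x n (hL.subset h) _).1 le_rfl).imp_right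
    fun ⟨k, hk, hr⟩ => ⟨k, h hk, hr⟩

lemma neg_le_freshest (δ : Fin N → ℝ≥0) (u : 𝒰) (x : ℕ → ℝ≥0) (n : Fin N) {K : Set ℕ}
    (hK : K.Finite) : -(δ n : ℝ) ≤ π.freshest δ u x n K :=
  (π.le_freshest_iff δ u x n hK _).2 (Or.inl le_rfl)

lemma freshest_started_le (δ : Fin N → ℝ≥0) (u : 𝒰) (x : ℕ → ℝ≥0) (n : Fin N) {t : ℝ}
    (ht : 0 ≤ t) : π.freshest δ u x n (π.started u x t) ≤ t := by
  rcases (π.le_freshest_iff δ u x n (π.finite_started u x t) _).1 le_rfl with h | ⟨k, hk, hn, h⟩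
  · exact h.trans ((neg_nonpos.2 (δ n).2).trans ht)
  · refine h.trans ?_
    have h1 := (π.arrived u x k (lt_of_le_of_lt hk ENNReal.ofReal_lt_top).ne).trans hk
    rw [hn] at h1
    have h2 : I.arr n (π.packet u x k).2 ≤ t.toNNReal := by
      have : ENNReal.ofReal t = (t.toNNReal : ℝ≥0∞) := rfl
      rw [this] at h1
      exact_mod_cast h1
    have h3 := (I.gen_le_arr n (π.packet u x k).2).trans h2
    calc (I.gen n (π.packet u x k).2 : ℝ) ≤ (t.toNNReal : ℝ) := by exact_mod_cast h3
      _ = t := Real.coe_toNNReal t ht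

lemma measurable_freshest (δ : Fin N → ℝ≥0) (n : Fin N) {Z : Type*} [MeasurableSpace Z]
    {f : Z → 𝒰 × (ℕ → ℝ≥0)} (hf : Measurable f) {E : ℕ → Set Z} (hE : ∀ k, MeasurableSet (E k)) :
    Measurable fun z => π.freshest δ (f z).1 (f z).2 n {k | z ∈ E k} := by
  classical
  have heq : (fun z => π.freshest δ (f z).1 (f z).2 n {k | z ∈ E k}) = fun z => ⨆ k,
      if z ∈ E k ∧ (π.packet (f z).1 (f z).2 k).1 = n
      then max (-(δ n : ℝ)) (I.gen n (π.packet (f z).1 (f z).2 k).2) else -(δ n : ℝ) := by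
    ext z
    rw [freshest, ← sSup_range]
    refine csSup_eq_csSup_of_forall_exists_le ?_ ?_
    · rintro s (rfl | ⟨k, hk, hn, rfl⟩)
      · refine ⟨_, mem_range_self 0, ?_⟩
        split_ifs
        · exact le_max_left _ _
        · exact le_rfl
      · refine ⟨_, mem_range_self k, ?_⟩
        rw [if_pos ⟨hk, hn⟩]
        exact le_max_right _ _
    · rintro _ ⟨k, rfl⟩
      dsimp only
      split_ifs with h
      · rcases max_choice (-(δ n : ℝ)) (I.gen n (π.packet (f z).1 (f z).2 k).2) with h' | h' <;>
          rw [h']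
        · exact ⟨_, mem_insert _ _, le_rfl⟩
        · exact ⟨_, mem_insert_of_mem _ ⟨k, h.1, h.2, rfl⟩, le_rfl⟩
      · exact ⟨_, mem_insert _ _, le_rfl⟩
  rw [heq]
  refine Measurable.iSup fun k => ?_
  have hp : Measurable fun z => π.packet (f z).1 (f z).2 k := (π.measurable_packet k).comp hf
  refine Measurable.ite ((hE k).inter ((measurable_fst.comp hp) (measurableSet_singleton n)))
    (measurable_const.max ?_) measurable_const
  exact (Measurable.of_discrete (f := fun p : Packet N => (I.gen n p.2 : ℝ))).comp hp

lemma measurable_freshest_started (δ : Fin N → ℝ≥0) (n : Fin N) :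
    Measurable fun z : (𝒰 × (ℕ → ℝ≥0)) × ℝ =>
      π.freshest δ z.1.1 z.1.2 n (π.started z.1.1 z.1.2 z.2) :=
  π.measurable_freshest δ n measurable_fst
    (E := fun k => {z | π.start z.1.1 z.1.2 k ≤ ENNReal.ofReal z.2})
    fun k => measurableSet_le ((π.measurable_start k).comp measurable_fst)
      (ENNReal.measurable_ofReal.comp measurable_snd)

lemma measurable_freshest_delivered (δ : Fin N → ℝ≥0) (n : Fin N) :
    Measurable fun z : (𝒰 × (ℕ → ℝ≥0)) × ℝ =>
      π.freshest δ z.1.1 z.1.2 n (π.delivered z.1.1 z.1.2 z.2) :=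
  π.measurable_freshest δ n measurable_fst
    (E := fun k => {z | π.start z.1.1 z.1.2 k + z.1.2 k ≤ ENNReal.ofReal z.2})
    fun k => measurableSet_le (((π.measurable_start k).comp measurable_fst).add (by fun_prop))
      (ENNReal.measurable_ofReal.comp measurable_snd)

/-- The number of flows whose freshest packet among the services in `K` was generated at time `v` or
later. -/
noncomputable def numFresh (δ : Fin N → ℝ≥0) (u : 𝒰) (x : ℕ → ℝ≥0) (v : ℝ) (K : Set ℕ) : ℕ :=
  (Finset.univ.filter fun n => v ≤ π.freshest δ u x n K).card

/-- Each delivery improves at most one flow, and a packet generated at time `v` or later cannot be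
served before the first such packet arrives at time `a`. -/
lemma numFresh_delivered_le (δ : Fin N → ℝ≥0) (u : 𝒰) (x : ℕ → ℝ≥0) {v : ℝ} {t a : ℝ≥0}
    (ha : ∀ n i, v ≤ I.gen n i → a ≤ I.arr n i) {K : ℕ} (hK : ∀ k, π.start u x k ≤ t → k < K) :
    π.numFresh δ u x v (π.delivered u x t) ≤
      (Finset.univ.filter fun n => v ≤ -(δ n : ℝ)).card +
        ((Finset.range K).filter fun j => a ≤ π.start u x j ∧ π.finish u x j ≤ t).card := by
  classical
  refine (Finset.card_le_card (t := (Finset.univ.filter fun n => v ≤ -(δ n : ℝ)) ∪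
    ((Finset.range K).filter fun j => a ≤ π.start u x j ∧ π.finish u x j ≤ t).image
      fun k => (π.packet u x k).1) fun n hn => ?_).trans
    ((Finset.card_union_le _ _).trans (Nat.add_le_add_left Finset.card_image_le _))
  have hn' := (Finset.mem_filter.1 hn).2
  rw [π.le_freshest_iff δ u x n (π.finite_delivered u x t)] at hn'
  rcases hn' with h | ⟨k, hk, hkn, hkv⟩
  · exact Finset.mem_union_left _ (by simpa using h)
  · refine Finset.mem_union_right _ (Finset.mem_image.2 ⟨k, ?_, hkn⟩)
    have hkt : π.finish u x k ≤ t := by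
      have : π.start u x k + x k ≤ ENNReal.ofReal t := hk
      rwa [ENNReal.ofReal_coe_nnreal] at this
    have hst := (π.start_le_finish u x k).trans hkt
    have harr := π.arrived u x k (hst.trans_lt ENNReal.coe_lt_top).ne
    rw [hkn] at harr
    refine Finset.mem_filter.2 ⟨Finset.mem_range.2 (hK k hst), le_trans ?_ harr, hkt⟩
    exact_mod_cast ha n _ hkv

variable {π}

open Classical in
/-- Under MASIF-LGFS, as long as some flow has not been served a packet generated at time `v` or
later although such packets have arrived for all flows, each service start brings one more flow to
this level. -/
lemma IsMASIFLGFS.min_le_card {δ : Fin N → ℝ≥0} (h : π.IsMASIFLGFS δ) (u : 𝒰) (x : ℕ → ℝ≥0) {v : ℝ}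
    {t a : ℝ≥0} {i₀ : ℕ} (hgen : ∀ n, v ≤ I.gen n i₀) (harr : ∀ n, I.arr n i₀ = a) (k : ℕ) :
    min N ((Finset.univ.filter fun n => v ≤ -(δ n : ℝ)).card +
        ((Finset.range k).filter fun j => a ≤ π.start u x j ∧ π.start u x j ≤ t).card) ≤
      (Finset.univ.filter fun n => v ≤ -(δ n : ℝ) ∨
        ∃ j < k, π.start u x j ≤ t ∧ π.Refreshes u x n v j).card := by
  induction k with
  | zero => simp
  | succ k ih =>
    have hsub : (Finset.univ.filter fun n => v ≤ -(δ n : ℝ) ∨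
          ∃ j < k, π.start u x j ≤ t ∧ π.Refreshes u x n v j) ⊆
        Finset.univ.filter fun n => v ≤ -(δ n : ℝ) ∨
          ∃ j < k + 1, π.start u x j ≤ t ∧ π.Refreshes u x n v j :=
      Finset.monotone_filter_right _ fun n _ => Or.imp_right
        fun ⟨j, hj, hr⟩ => ⟨j, hj.trans (Nat.lt_succ_self k), hr⟩
    rw [Finset.range_add_one, Finset.filter_insert]
    by_cases hk : a ≤ π.start u x k ∧ π.start u x k ≤ t
    swap
    · rw [if_neg hk]
      exact ih.trans (Finset.card_le_card hsub)
    rw [if_pos hk, Finset.card_insert_of_notMem (by simp)]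
    have hkt : π.start u x k ≠ ⊤ := (hk.2.trans_lt ENNReal.coe_lt_top).ne
    have hlow : ∀ n, (n ∉ Finset.univ.filter fun n => v ≤ -(δ n : ℝ) ∨
        ∃ j < k, π.start u x j ≤ t ∧ π.Refreshes u x n v j) ↔
          π.freshest δ u x n {j | j < k} < v := by
      intro n
      rw [← not_le, π.le_freshest_iff δ u x n (finite_lt_nat k)]
      simp only [Finset.mem_filter, Finset.mem_univ, true_and]
      refine not_congr (or_congr_right ⟨fun ⟨j, hj, _, hr⟩ => ⟨j, hj, hr⟩,
        fun ⟨j, hj, hr⟩ => ⟨j, hj, (π.start_mono u x (le_of_lt hj)).trans hk.2, hr⟩⟩)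
    have hwait : ∀ n, π.freshest δ u x n {j | j < k} < v → π.Waiting u x k (n, i₀) := by
      refine fun n hn => ⟨by simpa [harr n] using hk.1, fun j hj hp => hn.not_ge ?_⟩
      rw [π.le_freshest_iff δ u x n (finite_lt_nat k)]
      exact Or.inr ⟨j, hj, by rw [hp], by rw [hp]; exact hgen n⟩
    by_cases hall : ∀ n, n ∈ Finset.univ.filter fun n => v ≤ -(δ n : ℝ) ∨
        ∃ j < k, π.start u x j ≤ t ∧ π.Refreshes u x n v j
    · refine (min_le_left _ _).trans ?_
      rw [Finset.eq_univ_of_forall fun n => hsub (hall n)]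
      simp
    · push Not at hall
      obtain ⟨n, hn⟩ := hall
      rw [hlow] at hn
      set m := (π.packet u x k).1 with hm
      have hle := h.masif u x k hkt _ (hwait n hn)
      rw [servedAge, servedAge, sub_le_sub_iff_left] at hle
      have hmlow : π.freshest δ u x m {j | j < k} < v := hle.trans_lt hn
      have hgenk := h.lgfs u x k hkt _ (hwait m hmlow) rfl
      have hssub := Finset.card_lt_card (Finset.ssubset_iff_of_subset hsub |>.2
        ⟨m, Finset.mem_filter.2 ⟨Finset.mem_univ _, Or.inr ⟨k, Nat.lt_succ_self k, hk.2, rfl,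
          (hgen m).trans (by exact_mod_cast hgenk)⟩⟩, (hlow m).2 hmlow⟩)
      omega

/-- If some server is idle under a work-conserving policy at a time in `[a, t]`, then by then all
packets that arrived at time `a` have been served. -/
lemma WorkConserving.exists_start_of_not_busyOn (h : π.WorkConserving) {u : 𝒰} {x : ℕ → ℝ≥0}
    {t a : ℝ≥0} (hb : ¬ π.BusyOn t a u x) {p : Packet N} (hp : I.arr p.1 p.2 = a) :
    ∃ k, π.start u x k ≤ t ∧ π.packet u x k = p := by
  unfold BusyOn at hb
  push Not at hb
  obtain ⟨τ, ha, ht, m, hm⟩ := hb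
  by_contra! hcon
  obtain ⟨k, hk1, hk2, hk3⟩ := h u x τ p (hp.trans_le ha)
    (fun k hk => hcon k (hk.trans (by exact_mod_cast ht))) m
  exact (hm k hk1 hk2).not_gt hk3

/-- Under MASIF-LGFS, the starts in `[a, t]` of a busy system bring as many flows to level `v` as
there are starts; if some server is idle in `[a, t]`, all flows have reached this level. -/
lemma IsMASIFLGFS.le_numFresh_started {δ : Fin N → ℝ≥0} (h : π.IsMASIFLGFS δ) {u : 𝒰}
    {x : ℕ → ℝ≥0} {v : ℝ} {t a : ℝ≥0} {i₀ : ℕ} (hgen : ∀ n, v ≤ I.gen n i₀)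
    (harr : ∀ n, I.arr n i₀ = a) {d K : ℕ} (hd : d ≤ N)
    (hc : π.BusyOn t a u x → d - (Finset.univ.filter fun n => v ≤ -(δ n : ℝ)).card ≤
      ((Finset.range K).filter fun j => a ≤ π.start u x j ∧ π.start u x j ≤ t).card) :
    d ≤ π.numFresh δ u x v (π.started u x t) := by
  classical
  by_cases hb : π.BusyOn t a u x
  · have h1 := hc hb
    have h2 := h.min_le_card u x (t := t) hgen harr K
    refine le_trans (le_trans (le_min hd ?_) h2) (Finset.card_le_card ?_)
    · omega
    · refine Finset.monotone_filter_right _ fun n _ hn => ?_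
      rw [π.le_freshest_iff δ u x n (π.finite_started u x t)]
      refine hn.imp_right fun ⟨j, _, hj, hr⟩ => ⟨j, ?_, hr⟩
      simpa [started] using hj
  · refine hd.trans (le_of_eq ?_)
    rw [numFresh, Finset.filter_true_of_mem, Finset.card_univ, Fintype.card_fin]
    intro n _
    rw [π.le_freshest_iff δ u x n (π.finite_started u x t)]
    obtain ⟨k, hk, hp⟩ := h.workConserving.exists_start_of_not_busyOn hb (p := (n, i₀)) (harr n)
    refine Or.inr ⟨k, ?_, by rw [hp], by rw [hp]; exact hgen n⟩
    simpa [started] using hk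

/-- The served information under MASIF-LGFS is stochastically fresher than the delivered information
under any policy. -/
lemma IsMASIFLGFS.measure_numFresh_le (hI : I.Synchronized) {δ : Fin N → ℝ≥0}
    (h : π.IsMASIFLGFS δ) (π' : Policy M I 𝒰) {μ : Measure ℝ≥0} [IsProbabilityMeasure μ]
    (hμ : ∀ τ q, μ (Ioi (τ + q)) ≤ μ (Ioi τ) * μ (Ioi q)) (u : 𝒰) (v : ℝ) (t : ℝ≥0) (d : ℕ) :
    Measure.infinitePi (fun _ : ℕ => μ) {x | d ≤ π'.numFresh δ u x v (π'.delivered u x t)} ≤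
      Measure.infinitePi (fun _ : ℕ => μ) {x | d ≤ π.numFresh δ u x v (π.started u x t)} := by
  rcases lt_or_ge N d with hdN | hd
  · have : {x | d ≤ π'.numFresh δ u x v (π'.delivered u x t)} = ∅ := by
      refine eq_empty_of_forall_notMem fun x hx => ?_
      have h1 : d ≤ π'.numFresh δ u x v (π'.delivered u x t) := hx
      have h2 : π'.numFresh δ u x v (π'.delivered u x t) ≤ N :=
        (Finset.card_le_univ _).trans_eq (Fintype.card_fin N)
      omega
    simp [this]
  obtain ⟨s, r, hsr⟩ := hI
  obtain ⟨K, hK⟩ := exists_start_bound (M := M) (𝒰 := 𝒰) I t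
  by_cases hex : ∃ n i, v ≤ I.gen n i ∧ I.arr n i ≤ t
  · obtain ⟨n₁, i₁, hg₁, ha₁⟩ := hex
    -- `i₀` is the first packet to arrive among those that were generated at time `v` or later.
    obtain ⟨i₀, ⟨hi₀, hi₀t⟩, hmin⟩ := exists_min_image {i | v ≤ s i ∧ r i ≤ t} r
      ((I.finite_arr n₁ t).subset fun i hi => by simpa [(hsr n₁ i).2] using hi.2)
      ⟨i₁, by simpa [(hsr n₁ i₁).1] using hg₁, by simpa [(hsr n₁ i₁).2] using ha₁⟩
    have ha : ∀ n i, v ≤ I.gen n i → r i₀ ≤ I.arr n i := by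
      intro n i hv
      rw [(hsr n i).1] at hv
      rw [(hsr n i).2]
      rcases le_or_gt (r i) t with hrt | hrt
      · exact hmin i ⟨hv, hrt⟩
      · exact hi₀t.trans hrt.le
    refine le_trans (measure_mono fun x hx => ?_) ((π'.measure_completions_le μ t (r i₀)
      (d - (Finset.univ.filter fun n => v ≤ -(δ n : ℝ)).card) K u).trans
      ((π.le_measure_starts μ hμ t (r i₀) _ u fun x => hK π u x).trans
        (measure_mono fun x hx => ?_)))
    · have h1 : d ≤ π'.numFresh δ u x v (π'.delivered u x t) := hx
      have h2 := π'.numFresh_delivered_le δ u x ha (hK π' u x)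
      simp only [mem_ofPred_eq]
      omega
    · exact h.le_numFresh_started (i₀ := i₀) (fun n => by rw [(hsr n i₀).1]; exact hi₀)
        (fun n => (hsr n i₀).2) hd hx
  · push Not at hex
    refine measure_mono fun x hx => le_trans (Set.mem_ofPred_eq ▸ hx) (Finset.card_le_card ?_)
    refine Finset.monotone_filter_right _ fun n _ hn => ?_
    rw [π'.le_freshest_iff δ u x n (π'.finite_delivered u x t)] at hn
    rw [π.le_freshest_iff δ u x n (π.finite_started u x t)]
    refine hn.imp_right fun ⟨k, hk, hkn, hkv⟩ => absurd (hex n _ hkv) (not_lt.2 ?_)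
    have hst : π'.start u x k ≤ t := by
      simpa [started] using π'.delivered_subset_started u x t hk
    have harr := (π'.arrived u x k (hst.trans_lt ENNReal.coe_lt_top).ne).trans hst
    rw [hkn] at harr
    exact_mod_cast harr

end Policy

/-! ### From levels to expected ages -/

lemma ofReal_sub_eq_lintegral (w t : ℝ) :
    ENNReal.ofReal (t - w) = ∫⁻ v in Iic t, if w < v then 1 else 0 := by
  have : (fun v : ℝ => if w < v then (1 : ℝ≥0∞) else 0) = (Ioi w).indicator 1 := by
    ext v; simp [indicator_apply]
  rw [this, lintegral_indicator_one measurableSet_Ioi, Measure.restrict_apply measurableSet_Ioi,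
    Ioi_inter_Iic, Real.volume_Ioc]

lemma sum_ite_lt_eq {N : ℕ} (w : Fin N → ℝ) (v : ℝ) :
    (∑ n, if w n < v then 1 else 0 : ℝ≥0∞) = ∑ d ∈ Finset.range N,
      if d + 1 ≤ (Finset.univ.filter fun n => v ≤ w n).card then 0 else 1 := by
  have h := Finset.card_filter_add_card_filter_not (s := (Finset.univ : Finset (Fin N)))
    fun n => v ≤ w n
  have hr : (Finset.range N).filter (fun d => ¬ d + 1 ≤
      (Finset.univ.filter fun n => v ≤ w n).card) =
        Finset.Ico (Finset.univ.filter fun n => v ≤ w n).card N := by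
    ext d
    simp only [Finset.mem_filter, Finset.mem_range, Finset.mem_Ico]
    omega
  have hl : (∑ n, if w n < v then 1 else 0 : ℝ≥0∞) =
      ((Finset.univ.filter fun n => ¬ v ≤ w n).card : ℝ≥0∞) := by
    simp [← Finset.sum_boole]
  have hr' : (∑ d ∈ Finset.range N, if d + 1 ≤ (Finset.univ.filter fun n => v ≤ w n).card
      then 0 else 1 : ℝ≥0∞) = ((Finset.range N).filter (fun d => ¬ d + 1 ≤
      (Finset.univ.filter fun n => v ≤ w n).card)).card := by
    rw [← Finset.sum_boole]
    simp only [ite_not]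
  rw [hl, hr', hr, Nat.card_Ico]
  congr 1
  rw [Finset.card_univ, Fintype.card_fin] at h
  omega

/-- If for every level `v` the number of coordinates of `F` that are at least `v` is stochastically
larger than that of `F'`, then the expected total distance of `F` below `t` is smaller. -/
lemma lintegral_sum_ofReal_sub_le {Y : Type*} [MeasurableSpace Y] {ν : Measure Y}
    [IsProbabilityMeasure ν] {N : ℕ} {F F' : Fin N → Y → ℝ} (hF : ∀ n, Measurable (F n))
    (hF' : ∀ n, Measurable (F' n))
    (h : ∀ (v : ℝ) (d : ℕ), ν {x | d ≤ (Finset.univ.filter fun n => v ≤ F' n x).card} ≤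
      ν {x | d ≤ (Finset.univ.filter fun n => v ≤ F n x).card}) (t : ℝ) :
    ∫⁻ x, ∑ n, ENNReal.ofReal (t - F n x) ∂ν ≤ ∫⁻ x, ∑ n, ENNReal.ofReal (t - F' n x) ∂ν := by
  have hmeas : ∀ {G : Fin N → Y → ℝ}, (∀ n, Measurable (G n)) → ∀ (v : ℝ) (d : ℕ),
      MeasurableSet {x | d ≤ (Finset.univ.filter fun n => v ≤ G n x).card} := by
    intro G hG v d
    simp only [Finset.card_filter]
    exact measurableSet_le measurable_const (Finset.measurable_fun_sum _ fun n _ =>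
      Measurable.ite (measurableSet_le measurable_const (hG n)) measurable_const measurable_const)
  have hswap : ∀ {G : Fin N → Y → ℝ}, (∀ n, Measurable (G n)) →
      ∫⁻ x, ∑ n, ENNReal.ofReal (t - G n x) ∂ν = ∫⁻ v in Iic t, ∑ d ∈ Finset.range N,
        (1 - ν {x | d + 1 ≤ (Finset.univ.filter fun n => v ≤ G n x).card}) := by
    intro G hG
    have hm : ∀ n, Measurable fun z : Y × ℝ => if G n z.1 < z.2 then (1 : ℝ≥0∞) else 0 := fun n =>
      Measurable.ite (measurableSet_lt ((hG n).comp measurable_fst) measurable_snd)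
        measurable_const measurable_const
    calc ∫⁻ x, ∑ n, ENNReal.ofReal (t - G n x) ∂ν
        = ∫⁻ x, (∫⁻ v in Iic t, ∑ n, if G n x < v then 1 else 0) ∂ν := by
          refine lintegral_congr fun x => ?_
          have hx : ∀ n, Measurable fun v : ℝ => if G n x < v then (1 : ℝ≥0∞) else 0 :=
            fun n => (hm n).comp (measurable_prodMk_left (x := x))
          rw [lintegral_finsetSum _ fun n _ => hx n]
          simp only [ofReal_sub_eq_lintegral]
      _ = ∫⁻ v in Iic t, ∫⁻ x, ∑ n, (if G n x < v then 1 else 0) ∂ν :=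
          lintegral_lintegral_swap (Finset.measurable_fun_sum _ fun n _ => hm n).aemeasurable
      _ = _ := by
          refine lintegral_congr fun v => ?_
          simp only [sum_ite_lt_eq]
          rw [lintegral_finsetSum _ fun d _ => Measurable.ite (hmeas hG v (d + 1))
            measurable_const measurable_const]
          refine Finset.sum_congr rfl fun d _ => ?_
          rw [← prob_compl_eq_one_sub (hmeas hG v (d + 1)),
            ← lintegral_indicator_one (hmeas hG v (d + 1)).compl]
          refine lintegral_congr fun x => ?_
          by_cases hd : d + 1 ≤ (Finset.univ.filter fun n => v ≤ G n x).card
          · rw [if_pos hd, indicator_of_notMem (by simpa using hd)]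
          · rw [if_neg hd, indicator_of_mem (by simpa using hd)]
            rfl
  rw [hswap hF, hswap hF']
  exact lintegral_mono fun v => Finset.sum_le_sum fun d _ => tsub_le_tsub_left (h v (d + 1)) 1

/-- If each level above `b` lies between two paths `D` and `W` for an expected time of at most `m`,
then the expected integrated gap between these paths is at most `m` per unit of height. -/
lemma lintegral_ofReal_sub_le_add {Y : Type*} [MeasurableSpace Y] {ν : Measure Y} [SFinite ν]
    {D W : Y × ℝ → ℝ} (hDm : Measurable D) (hWm : Measurable W) {b T : ℝ} {m : ℝ≥0∞}
    (hb : ∀ x t, b ≤ D (x, t)) (ht : ∀ x t, 0 ≤ t → W (x, t) ≤ t)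
    (hgap : ∀ v, b < v →
      ∫⁻ x, (∫⁻ t in Ioc 0 T, if D (x, t) < v ∧ v ≤ W (x, t) then 1 else 0) ∂ν ≤ m) :
    ∫⁻ x, (∫⁻ t in Ioc 0 T, ENNReal.ofReal (t - D (x, t))) ∂ν ≤
      ∫⁻ x, (∫⁻ t in Ioc 0 T, ENNReal.ofReal (t - W (x, t))) ∂ν +
        ENNReal.ofReal (T - b) * m := by
  let g : Y → ℝ → ℝ → ℝ≥0∞ := fun x t v => if D (x, t) < v ∧ v ≤ W (x, t) then 1 else 0
  have hg : Measurable fun z : (Y × ℝ) × ℝ => g z.1.1 z.1.2 z.2 :=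
    Measurable.ite ((measurableSet_lt (hDm.comp measurable_fst) measurable_snd).inter
      (measurableSet_le measurable_snd (hWm.comp measurable_fst))) measurable_const measurable_const
  have hg' : Measurable fun z : (Y × ℝ) × ℝ => g z.1.1 z.2 z.1.2 :=
    hg.comp (f := fun z : (Y × ℝ) × ℝ => ((z.1.1, z.2), z.1.2)) (by fun_prop)
  have hWo : Measurable fun z : Y × ℝ => ENNReal.ofReal (z.2 - W z) :=
    (measurable_snd.sub hWm).ennreal_ofReal
  have hpoint : ∀ x, ∀ t ∈ Ioc 0 T, ENNReal.ofReal (t - D (x, t)) ≤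
      ENNReal.ofReal (t - W (x, t)) + ∫⁻ v in Ioc b T, g x t v := by
    intro x t htT
    have h1 : ∫⁻ v in Ioc b T, g x t v = ENNReal.ofReal (W (x, t) - D (x, t)) := by
      have hgi : g x t = (Ioc (D (x, t)) (W (x, t))).indicator 1 := by
        ext v; simp [g, indicator_apply]
      rw [hgi, lintegral_indicator_one measurableSet_Ioc, Measure.restrict_apply measurableSet_Ioc,
        inter_eq_left.2, Real.volume_Ioc]
      exact Ioc_subset_Ioc (hb x t) ((ht x t htT.1.le).trans htT.2)
    rw [h1]
    refine le_trans (le_of_eq ?_) ENNReal.ofReal_add_le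
    congr 1
    ring
  calc ∫⁻ x, (∫⁻ t in Ioc 0 T, ENNReal.ofReal (t - D (x, t))) ∂ν
      ≤ ∫⁻ x, ((∫⁻ t in Ioc 0 T, ENNReal.ofReal (t - W (x, t))) +
          ∫⁻ t in Ioc 0 T, ∫⁻ v in Ioc b T, g x t v) ∂ν := by
        refine lintegral_mono fun x => ?_
        exact (setLIntegral_mono' measurableSet_Ioc (hpoint x)).trans_eq
          (lintegral_add_left (hWo.comp (measurable_prodMk_left (x := x))) _)
    _ = ∫⁻ x, (∫⁻ t in Ioc 0 T, ENNReal.ofReal (t - W (x, t))) ∂ν +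
          ∫⁻ x, (∫⁻ t in Ioc 0 T, ∫⁻ v in Ioc b T, g x t v) ∂ν :=
        lintegral_add_left (Measurable.lintegral_prod_right' hWo) _
    _ ≤ _ := by
        gcongr
        calc ∫⁻ x, (∫⁻ t in Ioc 0 T, ∫⁻ v in Ioc b T, g x t v) ∂ν
            = ∫⁻ x, (∫⁻ v in Ioc b T, ∫⁻ t in Ioc 0 T, g x t v) ∂ν := by
              refine lintegral_congr fun x => lintegral_lintegral_swap ?_
              exact (hg.comp (f := fun z : ℝ × ℝ => ((x, z.1), z.2)) (by fun_prop)).aemeasurable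
          _ = ∫⁻ v in Ioc b T, ∫⁻ x, (∫⁻ t in Ioc 0 T, g x t v) ∂ν :=
              lintegral_lintegral_swap (Measurable.lintegral_prod_right' hg').aemeasurable
          _ ≤ ∫⁻ v in Ioc b T, m :=
              setLIntegral_mono' measurableSet_Ioc fun v hv => hgap v hv.1
          _ = ENNReal.ofReal (T - b) * m := by
              rw [setLIntegral_const, Real.volume_Ioc, mul_comm]

namespace Policy

variable {N M : ℕ} {I : Traffic N} {𝒰 : Type*} [MeasurableSpace 𝒰] {π : Policy M I 𝒰}

/-- At every time, the expected total age of served information under MASIF-LGFS is at most the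
expected total age under any policy. -/
lemma IsMASIFLGFS.lintegral_servedAge_le (hI : I.Synchronized) {δ : Fin N → ℝ≥0}
    (h : π.IsMASIFLGFS δ) (π' : Policy M I 𝒰) {μ : Measure ℝ≥0} [IsProbabilityMeasure μ]
    (hμ : ∀ τ q, μ (Ioi (τ + q)) ≤ μ (Ioi τ) * μ (Ioi q)) (u : 𝒰) {t : ℝ} (ht : 0 ≤ t) :
    ∫⁻ x, ∑ n, ENNReal.ofReal (t - π.freshest δ u x n (π.started u x t))
        ∂(Measure.infinitePi fun _ : ℕ => μ) ≤
      ∫⁻ x, ∑ n, ENNReal.ofReal (t - π'.freshest δ u x n (π'.delivered u x t))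
        ∂(Measure.infinitePi fun _ : ℕ => μ) := by
  have hz : Measurable fun x : ℕ → ℝ≥0 => ((u, x), t) := by fun_prop
  lift t to ℝ≥0 using ht
  exact lintegral_sum_ofReal_sub_le (fun n => (π.measurable_freshest_started δ n).comp hz)
    (fun n => (π'.measurable_freshest_delivered δ n).comp hz)
    (fun v d => h.measure_numFresh_le hI π' hμ u v t d) t

/-! ### The gap between served and delivered information -/

variable (π)

/-- The `k`-th service starts by time `T`, and it is the first one that is given to a packet of flow
`n` generated at time `v` or later. -/
def firstRefresh (u : 𝒰) (n : Fin N) (v T : ℝ) (k : ℕ) : Set (ℕ → ℝ≥0) :=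
  {x | π.start u x k ≤ ENNReal.ofReal T ∧ π.Refreshes u x n v k ∧
    ∀ j < k, ¬ π.Refreshes u x n v j}

lemma measurableSet_firstRefresh (u : 𝒰) (n : Fin N) (v T : ℝ) (k : ℕ) :
    MeasurableSet (π.firstRefresh u n v T k) := by
  have hR : ∀ j, MeasurableSet {x | π.Refreshes u x n v j} := fun j =>
    ((π.measurable_packet j).comp (measurable_prodMk_left (x := u)))
      (MeasurableSet.of_discrete (s := {p : Packet N | p.1 = n ∧ v ≤ I.gen n p.2}))
  refine (measurableSet_le ((π.measurable_start k).comp measurable_prodMk_left)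
    measurable_const).inter ((hR k).inter ?_)
  have : {x | ∀ j < k, ¬ π.Refreshes u x n v j} = ⋂ j, ⋂ _ : j < k, {x | π.Refreshes u x n v j}ᶜ := by
    ext x; simp
  change MeasurableSet {x | ∀ j < k, ¬ π.Refreshes u x n v j}
  rw [this]
  exact .iInter fun j => .iInter fun _ => (hR j).compl

lemma update_mem_firstRefresh_iff (u : 𝒰) (n : Fin N) (v T : ℝ) (k : ℕ) (x : ℕ → ℝ≥0) (y : ℝ≥0) :
    Function.update x k y ∈ π.firstRefresh u n v T k ↔ x ∈ π.firstRefresh u n v T k := by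
  simp only [firstRefresh, mem_ofPred_eq, Refreshes, π.start_update u x le_rfl]
  refine and_congr_right fun hk => ?_
  have hp : ∀ j ≤ k, π.packet u (Function.update x k y) j = π.packet u x j := fun j hj =>
    π.packet_update u x hj y
      (((π.start_mono u x hj).trans hk).trans_lt ENNReal.ofReal_lt_top).ne
  rw [hp k le_rfl]
  refine and_congr_right fun _ => forall_congr' fun j => imp_congr_right fun hj => ?_
  rw [hp j hj.le]

/-- The service that first brings flow `n` to level `v` is chosen before its duration is known, so
its expected duration is at most the mean service time. -/
lemma lintegral_firstRefresh_le (μ : Measure ℝ≥0) [IsProbabilityMeasure μ] (u : 𝒰) (n : Fin N)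
    (v T : ℝ) :
    ∫⁻ x, ∑' k, (π.firstRefresh u n v T k).indicator (fun x => (x k : ℝ≥0∞)) x
        ∂(Measure.infinitePi fun _ : ℕ => μ) ≤ ∫⁻ y, (y : ℝ≥0∞) ∂μ := by
  have hm := π.measurableSet_firstRefresh u n v T
  have hmi : ∀ k, Measurable
      ((π.firstRefresh u n v T k).indicator fun x : ℕ → ℝ≥0 => (x k : ℝ≥0∞)) :=
    fun k => Measurable.indicator (by fun_prop) (hm k)
  rw [lintegral_tsum fun k => (hmi k).aemeasurable]
  have hk : ∀ k, ∫⁻ x, (π.firstRefresh u n v T k).indicator (fun x => (x k : ℝ≥0∞)) x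
      ∂(Measure.infinitePi fun _ : ℕ => μ) =
        Measure.infinitePi (fun _ : ℕ => μ) (π.firstRefresh u n v T k) *
          ∫⁻ y, (y : ℝ≥0∞) ∂μ := by
    intro k
    rw [lintegral_update_infinitePi μ k (hmi k), mul_comm, ← lintegral_indicator_const (hm k)]
    refine lintegral_congr fun x => ?_
    by_cases hx : x ∈ π.firstRefresh u n v T k
    · rw [indicator_of_mem hx]
      refine lintegral_congr fun y => ?_
      rw [indicator_of_mem ((π.update_mem_firstRefresh_iff u n v T k x y).2 hx),
        Function.update_self]
    · rw [indicator_of_notMem hx]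
      refine (lintegral_congr fun y => ?_).trans lintegral_zero
      rw [indicator_of_notMem fun h => hx ((π.update_mem_firstRefresh_iff u n v T k x y).1 h)]
  have hdisj : Pairwise (Function.onFun Disjoint (π.firstRefresh u n v T)) := by
    intro i j hij
    refine disjoint_left.2 fun x hi hj => ?_
    rcases lt_or_gt_of_ne hij with h | h
    · exact hj.2.2 i h hi.2.1
    · exact hi.2.2 j h hj.2.1
  simp only [hk]
  rw [ENNReal.tsum_mul_right, ← measure_iUnion hdisj hm]
  exact mul_le_of_le_one_left' prob_le_one

/-- A level `v` is reached by the served but not by the delivered information only while the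
service that first reaches it is in progress. -/
lemma lintegral_level_gap_le (δ : Fin N → ℝ≥0) (u : 𝒰) (x : ℕ → ℝ≥0) (n : Fin N) {v T : ℝ}
    (hv : -(δ n : ℝ) < v) :
    ∫⁻ t in Ioc 0 T, (if π.freshest δ u x n (π.delivered u x t) < v ∧
        v ≤ π.freshest δ u x n (π.started u x t) then 1 else 0) ≤
      ∑' k, (π.firstRefresh u n v T k).indicator (fun x => (x k : ℝ≥0∞)) x := by
  classical
  have hiff : ∀ {K : Set ℕ}, K.Finite →
      (v ≤ π.freshest δ u x n K ↔ ∃ k ∈ K, π.Refreshes u x n v k) := fun hK =>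
    (π.le_freshest_iff δ u x n hK v).trans (or_iff_right hv.not_ge)
  by_cases hex : ∃ k, π.start u x k ≤ ENNReal.ofReal T ∧ π.Refreshes u x n v k
  · obtain ⟨k₁, hk₁, hr₁⟩ := hex
    have hR : ∃ k, π.Refreshes u x n v k := ⟨k₁, hr₁⟩
    set k := Nat.find hR with hkdef
    have hkT : π.start u x k ≤ ENNReal.ofReal T :=
      (π.start_mono u x (Nat.find_min' hR hr₁)).trans hk₁
    have hmem : x ∈ π.firstRefresh u n v T k :=
      ⟨hkT, Nat.find_spec hR, fun j hj => Nat.find_min hR hj⟩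
    refine le_trans ?_ (ENNReal.le_tsum k)
    rw [indicator_of_mem hmem]
    obtain ⟨s, hs⟩ := exists_coe_eq (hkT.trans_lt ENNReal.ofReal_lt_top).ne
    calc _ ≤ ∫⁻ t in Ioc 0 T, (Ico (s : ℝ) (s + x k)).indicator 1 t := by
          refine setLIntegral_mono' measurableSet_Ioc fun t ht => ?_
          split_ifs with hc
          · obtain ⟨hd, hst⟩ := hc
            rw [hiff (π.finite_started u x t)] at hst
            rw [← not_le, hiff (π.finite_delivered u x t)] at hd
            obtain ⟨j, hj, hjr⟩ := hst
            have h1 : (s : ℝ≥0∞) ≤ ENNReal.ofReal t :=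
              hs.trans_le ((π.start_mono u x (Nat.find_min' hR hjr)).trans hj)
            have h2 : ENNReal.ofReal t < s + x k := by
              rw [hs]
              exact not_le.1 fun h => hd ⟨k, h, Nat.find_spec hR⟩
            have ht0 : 0 ≤ t := ht.1.le
            lift t to ℝ≥0 using ht0
            rw [ENNReal.ofReal_coe_nnreal] at h1 h2
            rw [indicator_of_mem]
            · rfl
            · exact ⟨by exact_mod_cast h1, by exact_mod_cast h2⟩
          · exact zero_le
      _ ≤ ∫⁻ t, (Ico (s : ℝ) (s + x k)).indicator 1 t := setLIntegral_le_lintegral _ _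
      _ = x k := by
          rw [lintegral_indicator_one measurableSet_Ico, Real.volume_Ico, add_sub_cancel_left,
            ENNReal.ofReal_coe_nnreal]
  · push Not at hex
    refine le_trans (le_of_eq ?_) zero_le
    refine (setLIntegral_congr_fun (g := fun _ => 0) measurableSet_Ioc fun t ht => if_neg ?_).trans
      lintegral_zero
    rintro ⟨-, hst⟩
    rw [hiff (π.finite_started u x t)] at hst
    obtain ⟨j, hj, hjr⟩ := hst
    exact hex j (le_trans hj (ENNReal.ofReal_le_ofReal ht.2)) hjr

/-- The integrated age of a flow exceeds the integrated age of its served information by at most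
the mean service time per unit of generation time. -/
lemma lintegral_age_le_servedAge_add (δ : Fin N → ℝ≥0) (μ : Measure ℝ≥0) [IsProbabilityMeasure μ]
    (u : 𝒰) (n : Fin N) (T : ℝ) :
    ∫⁻ x, (∫⁻ t in Ioc 0 T, ENNReal.ofReal (t - π.freshest δ u x n (π.delivered u x t)))
        ∂(Measure.infinitePi fun _ : ℕ => μ) ≤
      ∫⁻ x, (∫⁻ t in Ioc 0 T, ENNReal.ofReal (t - π.freshest δ u x n (π.started u x t)))
        ∂(Measure.infinitePi fun _ : ℕ => μ) +
      ENNReal.ofReal (T + δ n) * ∫⁻ y, (y : ℝ≥0∞) ∂μ := by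
  have hz : Measurable fun z : (ℕ → ℝ≥0) × ℝ => ((u, z.1), z.2) := by fun_prop
  refine (lintegral_ofReal_sub_le_add (b := -(δ n : ℝ))
    ((π.measurable_freshest_delivered δ n).comp hz) ((π.measurable_freshest_started δ n).comp hz)
    (fun x t => π.neg_le_freshest δ u x n (π.finite_delivered u x t))
    (fun x t ht => π.freshest_started_le δ u x n ht)
    (fun v hv => (lintegral_mono fun x => π.lintegral_level_gap_le δ u x n hv).trans
      (π.lintegral_firstRefresh_le μ u n v T))).trans_eq ?_
  rw [sub_neg_eq_add]
  rfl

end Policy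

/-! ### Long-run average ages -/

namespace Policy

variable {N M : ℕ} {I : Traffic N} {𝒰 : Type*} [MeasurableSpace 𝒰] {π : Policy M I 𝒰}

lemma ofReal_avgAge (π : Policy M I 𝒰) (δ : Fin N → ℝ≥0) (u : 𝒰) (x : ℕ → ℝ≥0) {t : ℝ}
    (ht : 0 ≤ t) :
    ENNReal.ofReal (π.avgAge δ u x t) = ENNReal.ofReal (1 / (N : ℝ)) *
      ∑ n, ENNReal.ofReal (t - π.freshest δ u x n (π.delivered u x t)) := by
  rw [avgAge, ENNReal.ofReal_mul (by positivity), ENNReal.ofReal_sum_of_nonneg]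
  · rfl
  · intro n _
    exact sub_nonneg.2 ((π.freshest_mono δ u x n (π.finite_started u x t)
      (π.delivered_subset_started u x t)).trans (π.freshest_started_le δ u x n ht))

lemma measurable_avgAge (π : Policy M I 𝒰) (δ : Fin N → ℝ≥0) :
    Measurable fun z : (𝒰 × (ℕ → ℝ≥0)) × ℝ => π.avgAge δ z.1.1 z.1.2 z.2 :=
  measurable_const.mul (Finset.measurable_fun_sum _ fun n _ =>
    measurable_snd.sub (π.measurable_freshest_delivered δ n))

/-- The comparison of integrated ages over a finite horizon, for a fixed seed. -/
lemma IsMASIFLGFS.lintegral_avgAge_le (hN : 1 ≤ N) (hI : I.Synchronized) {δ : Fin N → ℝ≥0}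
    (h : π.IsMASIFLGFS δ) (π' : Policy M I 𝒰) {μ : Measure ℝ≥0} [IsProbabilityMeasure μ]
    (hμ : ∀ τ q, μ (Ioi (τ + q)) ≤ μ (Ioi τ) * μ (Ioi q)) (u : 𝒰) {T : ℝ} (hT : 0 ≤ T) :
    ∫⁻ x, (∫⁻ t in Ioc 0 T, ENNReal.ofReal (π.avgAge δ u x t))
        ∂(Measure.infinitePi fun _ : ℕ => μ) ≤
      ∫⁻ x, (∫⁻ t in Ioc 0 T, ENNReal.ofReal (π'.avgAge δ u x t))
        ∂(Measure.infinitePi fun _ : ℕ => μ) +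
      ENNReal.ofReal (T + 1 / (N : ℝ) * ∑ n, (δ n : ℝ)) * ∫⁻ y, (y : ℝ≥0∞) ∂μ := by
  have hz : Measurable fun z : (ℕ → ℝ≥0) × ℝ => ((u, z.1), z.2) := by fun_prop
  have hd : ∀ (ρ : Policy M I 𝒰) n, Measurable fun z : (ℕ → ℝ≥0) × ℝ =>
      ENNReal.ofReal (z.2 - ρ.freshest δ u z.1 n (ρ.delivered u z.1 z.2)) := fun ρ n =>
    (measurable_snd.sub ((ρ.measurable_freshest_delivered δ n).comp hz)).ennreal_ofReal
  have hs : ∀ n, Measurable fun z : (ℕ → ℝ≥0) × ℝ =>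
      ENNReal.ofReal (z.2 - π.freshest δ u z.1 n (π.started u z.1 z.2)) := fun n =>
    (measurable_snd.sub ((π.measurable_freshest_started δ n).comp hz)).ennreal_ofReal
  set ν := Measure.infinitePi fun _ : ℕ => μ
  set κ := ENNReal.ofReal (1 / (N : ℝ))
  have hage : ∀ ρ : Policy M I 𝒰,
      ∫⁻ x, (∫⁻ t in Ioc 0 T, ENNReal.ofReal (ρ.avgAge δ u x t)) ∂ν = κ * ∫⁻ x, (∫⁻ t in Ioc 0 T,
        ∑ n, ENNReal.ofReal (t - ρ.freshest δ u x n (ρ.delivered u x t))) ∂ν := by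
    intro ρ
    rw [← lintegral_const_mul _ (Measurable.lintegral_prod_right'
      (Finset.measurable_fun_sum Finset.univ fun n _ => hd ρ n))]
    refine lintegral_congr fun x => ?_
    refine Eq.trans ?_ (lintegral_const_mul κ ((Finset.measurable_fun_sum Finset.univ
      fun n _ => hd ρ n).comp (measurable_prodMk_left (x := x))))
    exact setLIntegral_congr_fun measurableSet_Ioc fun t ht => ρ.ofReal_avgAge δ u x ht.1.le
  have hsum : ∀ {f : Fin N → (ℕ → ℝ≥0) × ℝ → ℝ≥0∞}, (∀ n, Measurable (f n)) →
      ∫⁻ x, (∫⁻ t in Ioc 0 T, ∑ n, f n (x, t)) ∂ν =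
        ∑ n, ∫⁻ x, (∫⁻ t in Ioc 0 T, f n (x, t)) ∂ν := by
    intro f hf
    rw [← lintegral_finsetSum _ fun n _ => Measurable.lintegral_prod_right' (hf n)]
    refine lintegral_congr fun x => ?_
    exact lintegral_finsetSum _ fun n _ => (hf n).comp (measurable_prodMk_left (x := x))
  have hserved : ∫⁻ x, (∫⁻ t in Ioc 0 T,
        ∑ n, ENNReal.ofReal (t - π.freshest δ u x n (π.started u x t))) ∂ν ≤
      ∫⁻ x, (∫⁻ t in Ioc 0 T,
        ∑ n, ENNReal.ofReal (t - π'.freshest δ u x n (π'.delivered u x t))) ∂ν := by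
    refine (lintegral_lintegral_swap
      (Finset.measurable_fun_sum Finset.univ fun n _ => hs n).aemeasurable).trans_le
        (le_trans ?_ (lintegral_lintegral_swap
          (Finset.measurable_fun_sum Finset.univ fun n _ => hd π' n).aemeasurable).ge)
    exact setLIntegral_mono' measurableSet_Ioc fun t ht =>
      h.lintegral_servedAge_le hI π' hμ u ht.1.le
  have hconst : κ * ∑ n, ENNReal.ofReal (T + δ n) =
      ENNReal.ofReal (T + 1 / (N : ℝ) * ∑ n, (δ n : ℝ)) := by
    rw [← ENNReal.ofReal_sum_of_nonneg fun n _ => add_nonneg hT (δ n).coe_nonneg,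
      ← ENNReal.ofReal_mul (by positivity), Finset.sum_add_distrib, mul_add]
    have : (N : ℝ) ≠ 0 := by positivity
    congr 2
    simp [this]
  rw [hage, hage, hsum (hd π)]
  calc κ * ∑ n, ∫⁻ x, (∫⁻ t in Ioc 0 T,
          ENNReal.ofReal (t - π.freshest δ u x n (π.delivered u x t))) ∂ν
      ≤ κ * ∑ n, (∫⁻ x, (∫⁻ t in Ioc 0 T,
          ENNReal.ofReal (t - π.freshest δ u x n (π.started u x t))) ∂ν +
            ENNReal.ofReal (T + δ n) * ∫⁻ y, (y : ℝ≥0∞) ∂μ) := by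
        gcongr with n
        exact π.lintegral_age_le_servedAge_add δ μ u n T
    _ = κ * ∫⁻ x, (∫⁻ t in Ioc 0 T,
          ∑ n, ENNReal.ofReal (t - π.freshest δ u x n (π.started u x t))) ∂ν +
        ENNReal.ofReal (T + 1 / (N : ℝ) * ∑ n, (δ n : ℝ)) * ∫⁻ y, (y : ℝ≥0∞) ∂μ := by
        rw [Finset.sum_add_distrib, mul_add, ← Finset.sum_mul, ← mul_assoc, hconst, hsum hs]
    _ ≤ _ := by gcongr

/-- The law of the seed and the service times is a product measure. -/
lemma lintegral_seed_service {Ω : Type*} [MeasurableSpace Ω] {P : Measure Ω}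
    [IsProbabilityMeasure P] {X : ℕ → Ω → ℝ≥0} (hX : ∀ k, Measurable (X k)) (hindep : iIndepFun X P)
    (hident : ∀ k, IdentDistrib (X k) (X 0) P P) {U : Ω → 𝒰} (hU : Measurable U)
    (hUX : IndepFun U (fun ω k => X k ω) P) {G : 𝒰 × (ℕ → ℝ≥0) → ℝ≥0∞} (hG : Measurable G) :
    ∫⁻ ω, G (U ω, fun k => X k ω) ∂P =
      ∫⁻ u, ∫⁻ x, G (u, x) ∂(Measure.infinitePi fun _ : ℕ => P.map (X 0)) ∂(P.map U) := by
  have : IsProbabilityMeasure (P.map (X 0)) := Measure.isProbabilityMeasure_map (hX 0).aemeasurable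
  have hXm : Measurable fun ω k => X k ω := measurable_pi_lambda _ hX
  have hlaw : P.map (fun ω k => X k ω) = Measure.infinitePi fun _ : ℕ => P.map (X 0) := by
    rw [hindep.map_fun_eq_infinitePi_map hX]
    congr 1
    ext1 k
    exact (hident k).map_eq
  rw [← hlaw, ← lintegral_prod _ hG.aemeasurable,
    ← (indepFun_iff_map_prod_eq_prod_map_map hU.aemeasurable hXm.aemeasurable).1 hUX,
    lintegral_map hG (hU.prodMk hXm)]

end Policy

/-- A term of size `(T + b) m` contributes at most `m` to a long-run average. -/
lemma limsup_div_le_add {f g : ℝ → ℝ≥0∞} {b : ℝ} {m : ℝ≥0∞} (hm : m ≠ ⊤)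
    (h : ∀ T, 0 ≤ T → f T ≤ g T + ENNReal.ofReal (T + b) * m) :
    limsup (fun T => f T / ENNReal.ofReal T) atTop ≤
      limsup (fun T => g T / ENNReal.ofReal T) atTop + m := by
  have hlim : Tendsto (fun T : ℝ => ENNReal.ofReal (1 + b / T) * m) atTop (nhds m) := by
    have h1 : Tendsto (fun T : ℝ => 1 + b / T) atTop (nhds (1 + 0)) :=
      tendsto_const_nhds.add (tendsto_const_nhds.div_atTop tendsto_id)
    have h2 := ENNReal.Tendsto.mul_const (ENNReal.tendsto_ofReal h1) (Or.inr hm)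
    simpa using h2
  refine ENNReal.le_of_forall_pos_le_add fun ε hε _ => ?_
  have hev : ∀ᶠ T : ℝ in atTop, f T / ENNReal.ofReal T ≤ g T / ENNReal.ofReal T + (m + ε) := by
    have hlt : m < m + ε := ENNReal.lt_add_right hm (by exact_mod_cast hε.ne')
    filter_upwards [hlim.eventually_le_const hlt, eventually_gt_atTop 0] with T hT hT0
    calc f T / ENNReal.ofReal T
        ≤ (g T + ENNReal.ofReal (T + b) * m) / ENNReal.ofReal T := by
          gcongr
          exact h T hT0.le
      _ = g T / ENNReal.ofReal T + ENNReal.ofReal (1 + b / T) * m := by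
          rw [ENNReal.add_div, mul_comm, mul_div_assoc, ← ENNReal.ofReal_div_of_pos hT0, mul_comm m,
            add_div, div_self hT0.ne']
      _ ≤ _ := by gcongr
  refine (limsup_le_limsup hev).trans ?_
  rw [limsup_add_const atTop (fun T => g T / ENNReal.ofReal T) (m + ε) (by isBoundedDefault)
    (by isBoundedDefault), add_assoc]

lemma Policy.IsMASIFLGFS.longRunAge_le {N M : ℕ} (hN : 1 ≤ N) {I : Traffic N} (hI : I.Synchronized)
    {δ : Fin N → ℝ≥0} {Ω : Type*} [MeasurableSpace Ω] {P : Measure Ω} [IsProbabilityMeasure P]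
    {𝒰 : Type*} [MeasurableSpace 𝒰] {X : ℕ → Ω → ℝ≥0} (hX : ∀ k, Measurable (X k))
    (hindep : iIndepFun X P) (hident : ∀ k, IdentDistrib (X k) (X 0) P P) (hNBU : IsNBU P (X 0))
    {U : Ω → 𝒰} (hU : Measurable U) (hUX : IndepFun U (fun ω k => X k ω) P)
    {π : Policy M I 𝒰} (h : π.IsMASIFLGFS δ) (π' : Policy M I 𝒰) :
    π.longRunAge δ P X U ≤ π'.longRunAge δ P X U + ∫⁻ ω, (X 0 ω : ℝ≥0∞) ∂P := by
  -- An infinite mean, which New-Better-than-Used in fact rules out, would make the bound trivial.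
  by_cases hm : ∫⁻ ω, (X 0 ω : ℝ≥0∞) ∂P = ⊤
  · simp [hm]
  have hprob : IsProbabilityMeasure (P.map (X 0)) :=
    Measure.isProbabilityMeasure_map (hX 0).aemeasurable
  have hprobU : IsProbabilityMeasure (P.map U) :=
    Measure.isProbabilityMeasure_map hU.aemeasurable
  have hμ : ∀ τ q, P.map (X 0) (Ioi (τ + q)) ≤ P.map (X 0) (Ioi τ) * P.map (X 0) (Ioi q) := by
    intro τ q
    simp only [Measure.map_apply (hX 0) measurableSet_Ioi]
    exact hNBU τ q
  have hmean : ∫⁻ ω, (X 0 ω : ℝ≥0∞) ∂P = ∫⁻ y, (y : ℝ≥0∞) ∂(P.map (X 0)) :=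
    (lintegral_map measurable_coe_nnreal_ennreal (hX 0)).symm
  refine limsup_div_le_add (b := 1 / (N : ℝ) * ∑ n, (δ n : ℝ)) hm fun T hT => ?_
  have hG : ∀ ρ : Policy M I 𝒰, Measurable fun z : 𝒰 × (ℕ → ℝ≥0) =>
      ∫⁻ t in Ioc 0 T, ENNReal.ofReal (ρ.avgAge δ z.1 z.2 t) := fun ρ =>
    Measurable.lintegral_prod_right' (ρ.measurable_avgAge δ).ennreal_ofReal
  rw [Policy.lintegral_seed_service hX hindep hident hU hUX (hG π),
    Policy.lintegral_seed_service hX hindep hident hU hUX (hG π'), hmean]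
  refine (lintegral_mono fun u => h.lintegral_avgAge_le hN hI π' hμ u hT).trans_eq ?_
  rw [lintegral_add_right _ measurable_const, lintegral_const, measure_univ, mul_one]

end StatusUpdate

theorem theorem3 {N M : ℕ} (hN : 1 ≤ N) (hM : 1 ≤ M)
    (I : StatusUpdate.Traffic N) (hI : I.Synchronized) (δ : Fin N → ℝ≥0)
    {Ω : Type*} [MeasurableSpace Ω] (P : Measure Ω) [IsProbabilityMeasure P]
    {𝒰 : Type*} [MeasurableSpace 𝒰]
    (X : ℕ → Ω → ℝ≥0) (hX : ∀ k, Measurable (X k))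
    (hindep : iIndepFun X P) (hident : ∀ k, IdentDistrib (X k) (X 0) P P)
    (hNBU : StatusUpdate.IsNBU P (X 0))
    (U : Ω → 𝒰) (hU : Measurable U) (hUX : IndepFun U (fun ω k => X k ω) P)
    (masif : StatusUpdate.Policy M I 𝒰) (hmasif : masif.IsMASIFLGFS δ) :
    (⨅ π : StatusUpdate.Policy M I 𝒰, π.longRunAge δ P X U) ≤ masif.longRunAge δ P X U ∧
      masif.longRunAge δ P X U ≤
        (⨅ π : StatusUpdate.Policy M I 𝒰, π.longRunAge δ P X U) + ∫⁻ ω, (X 0 ω : ℝ≥0∞) ∂P := by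
  refine ⟨iInf_le _ masif, ?_⟩
  rw [ENNReal.iInf_add]
  exact le_iInf fun π => hmasif.longRunAge_le hN hI hX hindep hident hNBU hU hUX π
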